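/- **Theorem 1.4 (with its flat form).** *Setting.* Let $TS^2$ be the tangent bundle of the unit sphere of $\mathbb R^3$, identified with the space of oriented lines of $\mathbb R^3$: a tangent vector $V\perp\xi$ at $\xi\in S^2$ is the line with direction $\xi$ whose point closest to the origin is $V$. Its canonical neutral metric is the symmetric form $\mathbb G$ with $\mathbb G(X,X)=\xi\cdot(V'\times\xi')$ for a tangent vector $X=(\xi',V')$ at $(\xi,V)$. Let $(\xi,\eta)\in\mathbb C^2$ also denote the tangent vector $\eta\,\partial_\xi+\bar\eta\,\partial_{\bar\xi}$ at the point with stereographic coordinate $\xi$ (projection from the south pole); in these coordinates $$\mathbb G=\frac{4}{(1+\xi\bar\xi)^2}\,\mathrm{Im}\Big(d\bar\eta\,d\xi+\frac{2\bar\xi\eta}{1+\xi\bar\xi}\,d\xi\,d\bar\xi\Big).$$ On $\mathbb R^{2,2}=\mathbb R^4$ take the flat metric $g=dx_1^2+dx_2^2-dx_3^2-dx_4^2$. Let $\Phi:\mathbb R^{2,2}\to TS^2$ be the conformal diffeomorphism onto the lines over the open upper hemisphere $|\xi|<1$ which is inverse to the coordinates $$x_1+ix_2=\frac{2\,(\eta+\xi^2\bar\eta-i(1+\xi\bar\xi)\xi)}{1-\xi^2\bar\xi^2},\qquad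 x_3+ix_4=\frac{2\,(\eta+\xi^2\bar\eta+i(1+\xi\bar\xi)\xi)}{1-\xi^2\bar\xi^2}.$$ Let $\gamma(t)=(\cos t,\sin t,0,0)$ and $\gamma^\perp(t)=(0,0,\cos t,\sin t)$, $0\le t\le 2\pi$, be the standard conjugate unit circles $S_0,S_0^\perp\subset\mathbb R^{2,2}$; their images $\Phi(S_0),\Phi(S_0^\perp)$ in $TS^2$ are again denoted $S_0,S_0^\perp$. Let $D=\{(x_1^2+x_2^2)^{1/2}+(x_3^2+x_4^2)^{1/2}\le1\}$ be the convex hull of $S_0\cup S_0^\perp$ in $\mathbb R^{2,2}$. For a metric $h$ on $M$ and an open set $U\subseteq M$, a *conformal map* $f:U\to M$ is a smooth map with $f^*h=\mu h$ for a nowhere vanishing function $\mu$ on $U$ (so $\mu=\pm\Omega^2$). The integral of $w$ over a parametrized curve $c:[0,2\pi]\to M$ is $\int_c w=\int_0^{2\pi}w(c(t))\,|h(c'(t),c'(t))|^{1/2}\,dt$; the line element $|h(c',c')|^{1/2}dt$ is written $d\tau$ for $\mathbb G$ and $dl$ for $g$. 1. Let $v:TS^2\to\mathbb R$ be a $C^2$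 solution of $\Delta_{\mathbb G}v=\mathbb G^{jk}\nabla_j\nabla_kv=0$, let $U\subseteq TS^2$ be open with $\Phi(D)\subseteq U$ (for instance $U=TS^2$), and let $f:U\to TS^2$ be a conformal map. Then $$\int_{f(S_0)}v\,d\tau=\int_{f(S_0^\perp)}v\,d\tau ,$$ where $f(S_0)$ and $f(S_0^\perp)$ are parametrized by $f\circ\Phi\circ\gamma$ and $f\circ\Phi\circ\gamma^\perp$. 2. Let $u:\mathbb R^{2,2}\to\mathbb R$ be a $C^2$ solution of $u_{x_1x_1}+u_{x_2x_2}-u_{x_3x_3}-u_{x_4x_4}=0$, let $U\subseteq\mathbb R^{2,2}$ be open with $D\subseteq U$ (for instance $U=\mathbb R^{2,2}$), and let $f:U\to\mathbb R^{2,2}$ be a conformal map. Then $$\int_{f(S_0)}u\,dl=\int_{f(S_0^\perp)}u\,dl ,$$ where $f(S_0)$ and $f(S_0^\perp)$ are parametrized by $f\circ\gamma$ and $f\circ\gamma^\perp$. -/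

import Mathlib

open scoped Manifold ContDiff

noncomputable section

namespace NeutralGeometry

/-! ### Metrics, conformal maps, line elements and the Laplace equation on manifolds -/

/-- A map `f` is conformal on a set `U` for the (pseudo-Riemannian) metric `g` when it is smooth on
`U` and `f^* g = μ g` on `U` for a nowhere vanishing function `μ`.  Since `g` is allowed to be of
neutral signature, `μ` may be `Ω ^ 2` (conformal) or `-Ω ^ 2` (anti-conformal). -/
def IsConformalOn {E H M : Type*} [NormedAddCommGroup E] [NormedSpace ℝ E] [TopologicalSpace H]
    (I : ModelWithCorners ℝ E H) [TopologicalSpace M] [ChartedSpace H M]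
    (g : (p : M) → TangentSpace I p → TangentSpace I p → ℝ) (f : M → M) (U : Set M) : Prop :=
  ContMDiffOn I I ∞ f U ∧
    ∃ μ : M → ℝ, ∀ p ∈ U, μ p ≠ 0 ∧
      ∀ X Y : TangentSpace I p, g (f p) (mfderiv I I f p X) (mfderiv I I f p Y) = μ p * g p X Y

/-- The integral of `v` along the curve `γ : [a, b] → M` with respect to the line element
`|g(γ', γ')| ^ (1/2) dt` induced by the metric `g`. -/
def lineIntegral {E H M : Type*} [NormedAddCommGroup E] [NormedSpace ℝ E] [TopologicalSpace H]
    (I : ModelWithCorners ℝ E H) [TopologicalSpace M] [ChartedSpace H M]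
    (g : (p : M) → TangentSpace I p → TangentSpace I p → ℝ) (v : M → ℝ) (γ : ℝ → M) (a b : ℝ) : ℝ :=
  ∫ t in a..b, v (γ t) *
    √|g (γ t) (mfderiv 𝓘(ℝ, ℝ) I γ t (1 : ℝ)) (mfderiv 𝓘(ℝ, ℝ) I γ t (1 : ℝ))|

/-- Coordinate space `ℝ⁴`. -/
abbrev R4 := EuclideanSpace ℝ (Fin 4)

/-- The `j`-th coordinate vector of `ℝ⁴`. -/
def basisVec (j : Fin 4) : R4 := EuclideanSpace.single j (1 : ℝ)

/-- The partial derivative `∂w/∂x_j` of a function on `ℝ⁴`. -/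
def pd (j : Fin 4) (w : R4 → ℝ) (x : R4) : ℝ := fderiv ℝ w x (basisVec j)

/-- The Christoffel symbol `Γ^l_{jk}` of a matrix `h` of metric components on `ℝ⁴`. -/
def christoffel (h : R4 → Matrix (Fin 4) (Fin 4) ℝ) (l j k : Fin 4) (x : R4) : ℝ :=
  (1 / 2) * ∑ m, (h x)⁻¹ l m *
    (pd j (fun y => h y k m) x + pd k (fun y => h y j m) x - pd m (fun y => h y j k) x)

/-- The Laplacian `h^{jk} ∇_j ∇_k w` of a function `w`, where `∇` is the Levi-Civita connection of
the metric with components `h` on `ℝ⁴`. -/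
def coordLaplacian (h : R4 → Matrix (Fin 4) (Fin 4) ℝ) (w : R4 → ℝ) (x : R4) : ℝ :=
  ∑ j, ∑ k, (h x)⁻¹ j k * (pd j (pd k w) x - ∑ l, christoffel h l j k x * pd l w x)

/-- The components `g(∂_j, ∂_k)` of the metric `g` in a local coordinate system, given as a
parametrisation `Ψ`. -/
def metricComponents {E H M : Type*} [NormedAddCommGroup E] [NormedSpace ℝ E] [TopologicalSpace H]
    (I : ModelWithCorners ℝ E H) [TopologicalSpace M] [ChartedSpace H M]
    (g : (p : M) → TangentSpace I p → TangentSpace I p → ℝ) (Ψ : R4 → M) (x : R4) :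
    Matrix (Fin 4) (Fin 4) ℝ :=
  Matrix.of fun j k =>
    g (Ψ x) (mfderiv 𝓘(ℝ, R4) I Ψ x (basisVec j)) (mfderiv 𝓘(ℝ, R4) I Ψ x (basisVec k))

/-- `Ψ` is a local coordinate system (given as a parametrisation) on the open set `W ⊆ ℝ⁴`: it is
smooth on `W` and its derivative is an isomorphism at each point of `W`. -/
structure IsLocalCoord {E H M : Type*} [NormedAddCommGroup E] [NormedSpace ℝ E]
    [TopologicalSpace H] (I : ModelWithCorners ℝ E H) [TopologicalSpace M] [ChartedSpace H M]
    (Ψ : R4 → M) (W : Set R4) : Prop where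
  isOpen : IsOpen W
  smooth : ContMDiffOn 𝓘(ℝ, R4) I ∞ Ψ W
  bijective : ∀ x ∈ W, Function.Bijective (mfderiv 𝓘(ℝ, R4) I Ψ x)

/-- `v` is a solution of the Laplace equation `Δ_g v = 0` on a 4-manifold: `v` is twice
continuously differentiable, and `g^{jk} ∇_j ∇_k v = 0` holds in local coordinates. -/
def IsLaplaceSolution {E H M : Type*} [NormedAddCommGroup E] [NormedSpace ℝ E]
    [TopologicalSpace H] (I : ModelWithCorners ℝ E H) [TopologicalSpace M] [ChartedSpace H M]
    (g : (p : M) → TangentSpace I p → TangentSpace I p → ℝ) (v : M → ℝ) : Prop :=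
  ContMDiff I 𝓘(ℝ, ℝ) 2 v ∧
    ∀ (Ψ : R4 → M) (W : Set R4), IsLocalCoord I Ψ W →
      ∀ x ∈ W, coordLaplacian (metricComponents I g Ψ) (v ∘ Ψ) x = 0

/-! ### The flat space `ℝ^{2,2}` -/

/-- The flat metric `dx₁² + dx₂² - dx₃² - dx₄²`. -/
def flatMetric (p : R4) (X Y : TangentSpace 𝓘(ℝ, R4) p) : ℝ :=
  let X' : R4 := X
  let Y' : R4 := Y
  X' 0 * Y' 0 + X' 1 * Y' 1 - X' 2 * Y' 2 - X' 3 * Y' 3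

/-- `u` is a (twice continuously differentiable) solution of the ultra-hyperbolic equation. -/
def IsUltraHyperbolicSolution (u : R4 → ℝ) : Prop :=
  ContDiff ℝ 2 u ∧
    ∀ x, pd 0 (pd 0 u) x + pd 1 (pd 1 u) x - pd 2 (pd 2 u) x - pd 3 (pd 3 u) x = 0

/-- The standard unit circle `S₀`, parametrised over `[0, 2π]`. -/
def circle (t : ℝ) : R4 := !₂[Real.cos t, Real.sin t, 0, 0]

/-- The conjugate unit circle `S₀^⊥`, parametrised over `[0, 2π]`. -/
def conjCircle (t : ℝ) : R4 := !₂[0, 0, Real.cos t, Real.sin t]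

/-- The convex hull of `S₀ ∪ S₀^⊥`, i.e. the set `|(x₁, x₂)| + |(x₃, x₄)| ≤ 1`. -/
def doubleCone : Set R4 := {x | √(x 0 ^ 2 + x 1 ^ 2) + √(x 2 ^ 2 + x 3 ^ 2) ≤ 1}

/-! ### The space `TS²` of oriented lines of `ℝ³` -/

/-- Euclidean 3-space. -/
abbrev R3 := EuclideanSpace ℝ (Fin 3)

instance : Fact (Module.finrank ℝ R3 = 2 + 1) := ⟨by simp⟩

/-- The unit sphere of `ℝ³`. -/
abbrev S2 := Metric.sphere (0 : R3) 1

/-- The tangent bundle of the sphere, with the smooth structure of the tangent bundle. -/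
abbrev TS2 := TangentBundle (𝓡 2) S2

/-- The model with corners of the 4-manifold `TS²`. -/
abbrev ITS2 := (𝓡 2).tangent

/-- The identification of `TS²` with the oriented lines of `ℝ³`: a point `p` is sent to
`(ξ, V)`, where `ξ` is the unit direction of the line, and `V ⊥ ξ` (a tangent vector to the sphere
at `ξ`, as a vector of `ℝ³`) is the point of the line closest to the origin. -/
def toLine (p : TS2) : R3 × R3 :=
  ((p.1 : R3), mfderiv (𝓡 2) 𝓘(ℝ, R3) (fun x : S2 => (x : R3)) p.1 p.2)

/-- The triple product `a · (b × c)`. -/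
def triple (a b c : R3) : ℝ := Matrix.det (Matrix.of ![a.ofLp, b.ofLp, c.ofLp])

/-- The canonical neutral metric on the space of oriented lines.  For a tangent vector `X` with
components `(ξ', V')` at the line `(ξ, V)` it is `G(X, X) = ξ · (V' × ξ')`; `canonicalMetric` is the
corresponding symmetric bilinear form.  In the coordinates `(ξ, η)` of `lineOfCoord` it reads
`4 (1 + ξ ξ̄)⁻² Im (dη̄ dξ + 2 ξ̄ η (1 + ξ ξ̄)⁻¹ dξ dξ̄)`. -/
def canonicalMetric (p : TS2) (X Y : TangentSpace ITS2 p) : ℝ :=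
  let X' : R3 × R3 := mfderiv ITS2 𝓘(ℝ, R3 × R3) toLine p X
  let Y' : R3 × R3 := mfderiv ITS2 𝓘(ℝ, R3 × R3) toLine p Y
  (1 / 2) * (triple (toLine p).1 X'.2 Y'.1 + triple (toLine p).1 Y'.2 X'.1)

/-- The vector of `ℝ³` with stereographic coordinate `ξ` (projection from the south pole). -/
def stereoVec (ξ : ℂ) : R3 :=
  !₂[2 * ξ.re / (1 + ‖ξ‖ ^ 2), 2 * ξ.im / (1 + ‖ξ‖ ^ 2), (1 - ‖ξ‖ ^ 2) / (1 + ‖ξ‖ ^ 2)]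

theorem stereoVec_mem (ξ : ℂ) : stereoVec ξ ∈ Metric.sphere (0 : R3) 1 := by
  have h : (1 + ‖ξ‖ ^ 2) ≠ 0 := by positivity
  have h2 : ‖ξ‖ ^ 2 = ξ.re ^ 2 + ξ.im ^ 2 := by
    rw [← Complex.normSq_eq_norm_sq, Complex.normSq_apply]; ring
  rw [mem_sphere_zero_iff_norm, EuclideanSpace.norm_eq, Real.sqrt_eq_one, Fin.sum_univ_three]
  simp only [stereoVec, Real.norm_eq_abs, sq_abs, PiLp.toLp_apply, Matrix.cons_val_zero,
    Matrix.cons_val_one, Matrix.cons_val]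
  field_simp
  rw [h2]
  ring

/-- The point of the sphere with stereographic coordinate `ξ`. -/
def stereo (ξ : ℂ) : S2 := ⟨stereoVec ξ, stereoVec_mem ξ⟩

/-- The point of `TS²` with complex coordinates `(ξ, η)`, i.e. the tangent vector
`η ∂/∂ξ + η̄ ∂/∂ξ̄` at the point of the sphere with stereographic coordinate `ξ`. -/
def lineOfCoord (ξ η : ℂ) : TS2 := ⟨stereo ξ, mfderiv 𝓘(ℝ, ℂ) (𝓡 2) stereo ξ η⟩

/-- The first conformal coordinate
`Z₁ = 2 (1 - ξ² ξ̄²)⁻¹ (η + ξ² η̄ - i (1 + ξ ξ̄) ξ)` of the line `(ξ, η)`, for `|ξ| < 1`. -/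
def confZ₁ (ξ η : ℂ) : ℂ :=
  2 / (1 - (‖ξ‖ : ℂ) ^ 4) * (η + ξ ^ 2 * star η - Complex.I * (1 + (‖ξ‖ : ℂ) ^ 2) * ξ)

/-- The second conformal coordinate
`Z₂ = 2 (1 - ξ² ξ̄²)⁻¹ (η + ξ² η̄ + i (1 + ξ ξ̄) ξ)` of the line `(ξ, η)`, for `|ξ| < 1`. -/
def confZ₂ (ξ η : ℂ) : ℂ :=
  2 / (1 - (‖ξ‖ : ℂ) ^ 4) * (η + ξ ^ 2 * star η + Complex.I * (1 + (‖ξ‖ : ℂ) ^ 2) * ξ)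

/-- The coordinate `ξ` of the line with conformal coordinates `(Z₁, Z₂)`. -/
def xiOf (Z₁ Z₂ : ℂ) : ℂ := Complex.I * (Z₁ - Z₂) / (2 + √(4 + ‖Z₁ - Z₂‖ ^ 2) : ℝ)

/-- The coordinate `η` of the line with conformal coordinates `(Z₁, Z₂)`. -/
def etaOf (Z₁ Z₂ : ℂ) : ℂ := (Z₁ + Z₂ - xiOf Z₁ Z₂ ^ 2 * star (Z₁ + Z₂)) / 4

theorem norm_xiOf_sq (Z₁ Z₂ : ℂ) :
    ‖xiOf Z₁ Z₂‖ ^ 2 = (√(4 + ‖Z₁ - Z₂‖ ^ 2) - 2) / (√(4 + ‖Z₁ - Z₂‖ ^ 2) + 2) := by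
  have h4 : √(4 + ‖Z₁ - Z₂‖ ^ 2) ^ 2 = 4 + ‖Z₁ - Z₂‖ ^ 2 := Real.sq_sqrt (by positivity)
  have h0 : 0 ≤ √(4 + ‖Z₁ - Z₂‖ ^ 2) := Real.sqrt_nonneg _
  rw [xiOf, norm_div, norm_mul, Complex.norm_I, one_mul, Complex.norm_real, Real.norm_eq_abs,
    abs_of_nonneg (by positivity)]
  set D := √(4 + ‖Z₁ - Z₂‖ ^ 2)
  have hD : D + 2 ≠ 0 := by positivity
  have hD' : 2 + D ≠ 0 := by positivity
  field_simp
  linear_combination -h4 * (D + 2)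

/-- The line with coordinates `ξ = xiOf Z₁ Z₂` and `η = etaOf Z₁ Z₂` lies over the open upper
hemisphere and has conformal coordinates `(Z₁, Z₂)`. -/
theorem confZ_of_xi_eta (Z₁ Z₂ : ℂ) :
    ‖xiOf Z₁ Z₂‖ < 1 ∧ confZ₁ (xiOf Z₁ Z₂) (etaOf Z₁ Z₂) = Z₁ ∧
      confZ₂ (xiOf Z₁ Z₂) (etaOf Z₁ Z₂) = Z₂ := by
  have hn := norm_xiOf_sq Z₁ Z₂
  have h0 : 0 ≤ √(4 + ‖Z₁ - Z₂‖ ^ 2) := Real.sqrt_nonneg _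
  have hlt : ‖xiOf Z₁ Z₂‖ ^ 2 < 1 := by
    rw [hn, div_lt_one (by positivity)]; linarith
  have hxi : xiOf Z₁ Z₂ * (2 + (√(4 + ‖Z₁ - Z₂‖ ^ 2) : ℝ)) = Complex.I * (Z₁ - Z₂) := by
    rw [xiOf]
    have : ((2 + √(4 + ‖Z₁ - Z₂‖ ^ 2) : ℝ) : ℂ) ≠ 0 := by
      exact_mod_cast (by positivity : (2 + √(4 + ‖Z₁ - Z₂‖ ^ 2) : ℝ) ≠ 0)
    rw [← Complex.ofReal_ofNat, ← Complex.ofReal_add]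
    field_simp
  have hcc : (‖xiOf Z₁ Z₂‖ : ℂ) ^ 2 = xiOf Z₁ Z₂ * star (xiOf Z₁ Z₂) := by
    rw [← Complex.ofReal_pow, ← Complex.normSq_eq_norm_sq, ← Complex.mul_conj]; rfl
  set D := √(4 + ‖Z₁ - Z₂‖ ^ 2)
  have hr : (‖xiOf Z₁ Z₂‖ : ℂ) ^ 2 * (D + 2) = D - 2 := by
    rw [eq_div_iff (by positivity)] at hn
    exact_mod_cast hn
  have hne : (1 : ℂ) - (‖xiOf Z₁ Z₂‖ : ℂ) ^ 4 ≠ 0 := by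
    have : (1 : ℝ) - ‖xiOf Z₁ Z₂‖ ^ 4 ≠ 0 := by nlinarith [sq_nonneg ‖xiOf Z₁ Z₂‖]
    exact_mod_cast this
  have hD : (D : ℂ) + 2 ≠ 0 := by exact_mod_cast (by positivity : (D + 2 : ℝ) ≠ 0)
  refine ⟨by nlinarith [norm_nonneg (xiOf Z₁ Z₂)], ?_, ?_⟩
  all_goals
    simp only [confZ₁, confZ₂]
    rw [div_mul_eq_mul_div, div_eq_iff hne]
    have e1 : etaOf Z₁ Z₂ + xiOf Z₁ Z₂ ^ 2 * star (etaOf Z₁ Z₂) =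
        (1 - (‖xiOf Z₁ Z₂‖ : ℂ) ^ 4) * (Z₁ + Z₂) / 4 := by
      rw [show (‖xiOf Z₁ Z₂‖ : ℂ) ^ 4 = ((‖xiOf Z₁ Z₂‖ : ℂ) ^ 2) ^ 2 by ring, hcc]
      simp only [etaOf, star_div₀, star_sub, star_mul', star_pow, star_star, star_add]
      rw [show star (4 : ℂ) = 4 by simp]
      ring
    have e2 : Complex.I * xiOf Z₁ Z₂ * 4 = -(1 - (‖xiOf Z₁ Z₂‖ : ℂ) ^ 2) * (Z₁ - Z₂) := by
      apply mul_right_cancel₀ hD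
      linear_combination 4 * Complex.I * hxi + (Z₁ - Z₂) * 4 * Complex.I_sq - (Z₁ - Z₂) * hr
    rw [e1]
    first
      | linear_combination (-1 / 2 : ℂ) * (1 + (‖xiOf Z₁ Z₂‖ : ℂ) ^ 2) * e2
      | linear_combination (1 / 2 : ℂ) * (1 + (‖xiOf Z₁ Z₂‖ : ℂ) ^ 2) * e2

/-- The local conformal map `ℝ^{2,2} → TS²` onto the oriented lines over the open upper hemisphere,
the inverse of the conformal coordinates `Z₁ = x₁ + i x₂`, `Z₂ = x₃ + i x₄`. -/
def conformalChart (x : R4) : TS2 :=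
  lineOfCoord (xiOf ⟨x 0, x 1⟩ ⟨x 2, x 3⟩) (etaOf ⟨x 0, x 1⟩ ⟨x 2, x 3⟩)

end NeutralGeometry

end

open NeutralGeometry

/-!
Both halves reduce to Asgeirsson's mean value theorem for the ultra-hyperbolic operator
`□ = ∂₁² + ∂₂² - ∂₃² - ∂₄²` on a neighbourhood of the double cone.  In either case the curves are
the images of the conjugate circles of `ℝ^{2,2}` under a smooth map `F` (the conformal map itself,
or its composition with `conformalChart`) that pulls the metric back to `λ η`, where `η` is the flat
metric.  The line integral of `v` is therefore the integral of `√|λ| (v ∘ F)` over a unit circle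
(`lineIntegral_comp`), and one has to show that `□ (√|λ| (v ∘ F)) = 0` (`box_sqrt_mul`).  This
follows from two facts.

* `v ∘ F` solves the Laplace equation of `λ η`, which reads `λ □w + ⟨∇λ, ∇w⟩ = 0`.  On lines this is
  the hypothesis on `v` in the local coordinates `F` (`box_of_coordLaplacian`); on flat space it is
  the chain rule and the Koszul formula for the second derivatives of a conformal map
  (`IsFlatConformal.box_comp`).
* `□ √|λ| = 0`, the vanishing of the scalar curvature of `λ η`.  For a conformal map of flat space
  this comes from comparing the divergence of `⟨□φ, ∂ⱼφ⟩ = -∂ⱼλ` with the second derivatives of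
  `⟨∂ᵢφ, ∂ⱼφ⟩ = λ ηᵢⱼ` (`IsFlatConformal.box_factor`).  On lines, describing a line by its slope and
  its intersection with a coordinate plane gives local charts (`lineChart`) in which the canonical
  metric is `η` times the square of a function annihilated by `□` (`box_chartWeight`), so that the
  conformal covariance of `□` under `lineChart i ∘ toLine ∘ F` applies
  (`box_sqrt_of_isFlatPullback`).

For Asgeirsson's theorem the solution is averaged over the rotations of the two planes.  The average
depends on the radii `r, s` only and solves `M_rr + M_r / r = M_ss + M_s / s`.  The difference
`N = M(r, s) - M(s, r)` vanishes on the characteristic line `r = s`, and an energy identity on the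
triangle `0 ≤ s ≤ r ≤ 1 - s`, two of whose sides are characteristic, forces `N = 0` at
`(r, s) = (1, 0)` (`goursat_eq_zero`).
-/

namespace NeutralGeometry

open Filter Topology MeasureTheory

/-! ### Partial derivatives and the wave operator -/

/-- The signs of the flat metric `dx₁² + dx₂² - dx₃² - dx₄²`. -/
def eps : Fin 4 → ℝ := ![1, 1, -1, -1]

/-- The ultra-hyperbolic operator `∂₁² + ∂₂² - ∂₃² - ∂₄²`. -/
noncomputable def box (w : R4 → ℝ) (x : R4) : ℝ := ∑ i, eps i * pd i (pd i w) x

theorem eps_mul_self (i : Fin 4) : eps i * eps i = 1 := by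
  fin_cases i <;> simp [eps]

section PartialDerivatives

variable {w u : R4 → ℝ} {x : R4}

theorem pd_congr {j : Fin 4} (h : w =ᶠ[𝓝 x] u) : pd j w x = pd j u x := by
  simp only [pd, h.fderiv_eq]

theorem pd_eventuallyEq {j : Fin 4} (h : w =ᶠ[𝓝 x] u) : pd j w =ᶠ[𝓝 x] pd j u :=
  h.eventually_nhds.mono fun _ hy => pd_congr hy

theorem box_congr (h : w =ᶠ[𝓝 x] u) : box w x = box u x := by
  simp only [box, pd_congr (pd_eventuallyEq h)]

theorem pd_const (j : Fin 4) (c : ℝ) : pd j (fun _ => c) = fun _ => 0 := by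
  funext x
  simp [pd]

theorem pd_add {j : Fin 4} (hw : DifferentiableAt ℝ w x) (hu : DifferentiableAt ℝ u x) :
    pd j (fun y => w y + u y) x = pd j w x + pd j u x := by
  simp [pd, fderiv_fun_add hw hu]

theorem pd_mul {j : Fin 4} (hw : DifferentiableAt ℝ w x) (hu : DifferentiableAt ℝ u x) :
    pd j (fun y => w y * u y) x = w x * pd j u x + pd j w x * u x := by
  simp [pd, fderiv_fun_mul hw hu, mul_comm]

theorem pd_const_mul {j : Fin 4} (c : ℝ) (hu : DifferentiableAt ℝ u x) :
    pd j (fun y => c * u y) x = c * pd j u x := by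
  simp [pd, fderiv_const_mul hu]

theorem pd_sum {ι : Type*} {s : Finset ι} {F : ι → R4 → ℝ} {j : Fin 4}
    (hF : ∀ i ∈ s, DifferentiableAt ℝ (F i) x) :
    pd j (fun y => ∑ i ∈ s, F i y) x = ∑ i ∈ s, pd j (F i) x := by
  simp [pd, fderiv_fun_sum hF]

theorem _root_.ContDiffAt.pd {m n : WithTop ℕ∞} {j : Fin 4} (hw : ContDiffAt ℝ n w x)
    (hmn : m + 1 ≤ n) : ContDiffAt ℝ m (pd j w) x :=
  (hw.fderiv_right hmn).clm_apply contDiffAt_const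

theorem _root_.ContDiffAt.differentiableAt_pd {j : Fin 4} (hw : ContDiffAt ℝ 2 w x) :
    DifferentiableAt ℝ (pd j w) x :=
  (hw.pd (m := 1) (by norm_num)).differentiableAt (by norm_num)

theorem pd_pd_eq {j k : Fin 4} (hw : ContDiffAt ℝ 2 w x) :
    pd j (pd k w) x = fderiv ℝ (fderiv ℝ w) x (basisVec j) (basisVec k) := by
  have h : DifferentiableAt ℝ (fderiv ℝ w) x :=
    (hw.fderiv_right (m := 1) (by norm_num)).differentiableAt (by norm_num)
  change fderiv ℝ (fun y => fderiv ℝ w y (basisVec k)) x (basisVec j) = _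
  rw [fderiv_clm_apply h (by fun_prop)]
  simp

theorem pd_comm {j k : Fin 4} (hw : ContDiffAt ℝ 2 w x) :
    pd j (pd k w) x = pd k (pd j w) x := by
  rw [pd_pd_eq hw, pd_pd_eq hw]
  exact (hw.isSymmSndFDerivAt (by simp)).eq _ _

/-- The derivative in terms of partial derivatives. -/
theorem fderiv_eq_sum_pd (X : R4) : fderiv ℝ w x X = ∑ j, X j * pd j w x := by
  have h : X = ∑ j, X j • basisVec j := by
    ext i
    simp [basisVec, Pi.single_apply]
  conv_lhs => rw [h]
  simp [pd]

theorem fderiv_apply_coord {φ : R4 → R4} (hφ : DifferentiableAt ℝ φ x) (X : R4) (m : Fin 4) :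
    fderiv ℝ φ x X m = fderiv ℝ (fun y => φ y m) x X := by
  have h : HasFDerivAt (fun y => φ y m)
      ((EuclideanSpace.proj (𝕜 := ℝ) m).comp (fderiv ℝ φ x)) x :=
    (EuclideanSpace.proj (𝕜 := ℝ) m).hasFDerivAt.comp x hφ.hasFDerivAt
  rw [h.fderiv]
  rfl

/-- The chain rule for partial derivatives. -/
theorem pd_comp {φ : R4 → R4} {j : Fin 4} (hw : DifferentiableAt ℝ w (φ x))
    (hφ : DifferentiableAt ℝ φ x) :
    pd j (fun y => w (φ y)) x = ∑ m, pd j (fun y => φ y m) x * pd m w (φ x) := by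
  have h : fderiv ℝ (fun y => w (φ y)) x = (fderiv ℝ w (φ x)).comp (fderiv ℝ φ x) :=
    fderiv_comp x hw hφ
  rw [pd, h, ContinuousLinearMap.comp_apply, fderiv_eq_sum_pd]
  exact Finset.sum_congr rfl fun m _ => by rw [fderiv_apply_coord hφ]; rfl

theorem eventually_contDiffAt_two (hw : ContDiffAt ℝ 2 w x) :
    ∀ᶠ y in 𝓝 x, ContDiffAt ℝ 2 w y := hw.eventually (by simp)

theorem box_mul (hw : ContDiffAt ℝ 2 w x) (hu : ContDiffAt ℝ 2 u x) :
    box (fun y => w y * u y) x =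
      w x * box u x + 2 * ∑ i, eps i * (pd i w x * pd i u x) + box w x * u x := by
  have h : ∀ i, pd i (pd i fun y => w y * u y) x =
      w x * pd i (pd i u) x + 2 * (pd i w x * pd i u x) + pd i (pd i w) x * u x := by
    intro i
    have e : pd i (fun y => w y * u y) =ᶠ[𝓝 x] fun y => w y * pd i u y + pd i w y * u y := by
      filter_upwards [eventually_contDiffAt_two hw, eventually_contDiffAt_two hu]
        with y h1 h2
      exact pd_mul (h1.differentiableAt (by norm_num)) (h2.differentiableAt (by norm_num))
    have dw := hw.differentiableAt (by norm_num)
    have du := hu.differentiableAt (by norm_num)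
    rw [pd_congr e, pd_add (dw.fun_mul hu.differentiableAt_pd) (hw.differentiableAt_pd.fun_mul du),
      pd_mul dw hu.differentiableAt_pd, pd_mul hw.differentiableAt_pd du]
    ring
  simp only [box, h, Finset.mul_sum, Finset.sum_mul, ← Finset.sum_add_distrib]
  exact Finset.sum_congr rfl fun i _ => by ring

end PartialDerivatives

/-! ### Conformal maps of flat space -/

/-- The components `ηᵢⱼ` of the flat metric. -/
def eta (i j : Fin 4) : ℝ := if i = j then eps i else 0

theorem eta_comm (i j : Fin 4) : eta i j = eta j i := by
  unfold eta; split_ifs with h1 h2 h2 <;> simp_all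

/-- The functions `F₁, …, F₄` are the components of a map which is conformal on the open set `W` for
the flat metric, with conformal factor `μ`. -/
structure IsFlatConformal (F : Fin 4 → R4 → ℝ) (μ : R4 → ℝ) (W : Set R4) : Prop where
  isOpen : IsOpen W
  contDiffOn : ∀ m, ContDiffOn ℝ 3 (F m) W
  ne_zero : ∀ y ∈ W, μ y ≠ 0
  conformal : ∀ y ∈ W, ∀ i j, ∑ m, eps m * (pd i (F m) y * pd j (F m) y) = μ y * eta i j

namespace IsFlatConformal

variable {F : Fin 4 → R4 → ℝ} {μ : R4 → ℝ} {W : Set R4} {x : R4}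

theorem contDiffAt (hF : IsFlatConformal F μ W) (hx : x ∈ W) (m : Fin 4) :
    ContDiffAt ℝ 3 (F m) x :=
  (hF.contDiffOn m).contDiffAt (hF.isOpen.mem_nhds hx)

theorem contDiffAt_two (hF : IsFlatConformal F μ W) (hx : x ∈ W) (m : Fin 4) :
    ContDiffAt ℝ 2 (F m) x :=
  (hF.contDiffAt hx m).of_le (by norm_num)

theorem contDiffAt_pd (hF : IsFlatConformal F μ W) (hx : x ∈ W) (i m : Fin 4) :
    ContDiffAt ℝ 2 (pd i (F m)) x :=
  (hF.contDiffAt hx m).pd (by norm_num)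

theorem differentiableAt_pd (hF : IsFlatConformal F μ W) (hx : x ∈ W) (i m : Fin 4) :
    DifferentiableAt ℝ (pd i (F m)) x :=
  (hF.contDiffAt_two hx m).differentiableAt_pd

theorem differentiableAt_pd_pd (hF : IsFlatConformal F μ W) (hx : x ∈ W) (i j m : Fin 4) :
    DifferentiableAt ℝ (pd i (pd j (F m))) x :=
  (hF.contDiffAt_pd hx j m).differentiableAt_pd

theorem contDiffAt_factor (hF : IsFlatConformal F μ W) (hx : x ∈ W) : ContDiffAt ℝ 2 μ x := by
  have h : ContDiffAt ℝ 2 (fun y => ∑ m, eps m * (pd 0 (F m) y * pd 0 (F m) y)) x :=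
    ContDiffAt.sum fun m _ =>
      contDiffAt_const.mul ((hF.contDiffAt_pd hx 0 m).mul (hF.contDiffAt_pd hx 0 m))
  refine h.congr_of_eventuallyEq ?_
  filter_upwards [hF.isOpen.mem_nhds hx] with y hy
  rw [hF.conformal y hy]
  simp [eta, eps]

theorem factor_deriv (hF : IsFlatConformal F μ W) (hx : x ∈ W) (k i j : Fin 4) :
    ∑ m, eps m * (pd k (pd i (F m)) x * pd j (F m) x) +
      ∑ m, eps m * (pd k (pd j (F m)) x * pd i (F m) x) = pd k μ x * eta i j := by
  have e : (fun y => ∑ m, eps m * (pd i (F m) y * pd j (F m) y)) =ᶠ[𝓝 x]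
      fun y => eta i j * μ y := by
    filter_upwards [hF.isOpen.mem_nhds hx] with y hy
    rw [hF.conformal y hy, mul_comm]
  have h := pd_congr (j := k) e
  rw [pd_const_mul _ ((hF.contDiffAt_factor hx).differentiableAt (by norm_num)),
    pd_sum fun m _ => ((hF.differentiableAt_pd hx i m).fun_mul
      (hF.differentiableAt_pd hx j m)).const_mul _] at h
  rw [mul_comm, ← h, ← Finset.sum_add_distrib]
  refine Finset.sum_congr rfl fun m _ => ?_
  rw [pd_const_mul _ ((hF.differentiableAt_pd hx i m).fun_mul (hF.differentiableAt_pd hx j m)),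
    pd_mul (hF.differentiableAt_pd hx i m) (hF.differentiableAt_pd hx j m)]
  ring

/-- The second derivatives of a conformal map in terms of the first derivatives of its factor:
the Koszul formula. -/
theorem hessian_inner (hF : IsFlatConformal F μ W) (hx : x ∈ W) (k i j : Fin 4) :
    ∑ m, eps m * (pd k (pd i (F m)) x * pd j (F m) x) =
      1 / 2 * (pd k μ x * eta i j + pd i μ x * eta k j - pd j μ x * eta k i) := by
  have h1 := hF.factor_deriv hx k i j
  have h2 := hF.factor_deriv hx i k j
  have h3 := hF.factor_deriv hx j k i
  simp only [fun m => pd_comm (j := i) (k := k) (hF.contDiffAt_two hx m),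
    fun m => pd_comm (j := j) (k := k) (hF.contDiffAt_two hx m),
    fun m => pd_comm (j := j) (k := i) (hF.contDiffAt_two hx m)] at h1 h2 h3
  linarith

theorem box_inner (hF : IsFlatConformal F μ W) (hx : x ∈ W) (j : Fin 4) :
    ∑ m, eps m * (box (F m) x * pd j (F m) x) = -pd j μ x := by
  have h : ∑ m, eps m * (box (F m) x * pd j (F m) x) =
      ∑ i, eps i * ∑ m, eps m * (pd i (pd i (F m)) x * pd j (F m) x) := by
    simp only [box, Finset.mul_sum, Finset.sum_mul]
    rw [Finset.sum_comm]
    exact Finset.sum_congr rfl fun i _ => Finset.sum_congr rfl fun m _ => by ring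
  rw [h]
  simp only [hF.hessian_inner hx]
  fin_cases j <;> simp [Fin.sum_univ_four, eta, eps] <;> ring

/-- The inverse metric is also preserved up to the factor `μ`. -/
theorem dual (hF : IsFlatConformal F μ W) (hx : x ∈ W) (m n : Fin 4) :
    ∑ i, eps i * (pd i (F m) x * pd i (F n) x) = μ x * eta m n := by
  have hμ := hF.ne_zero x hx
  let A : Matrix (Fin 4) (Fin 4) ℝ := Matrix.of fun i m => pd i (F m) x
  let B : Matrix (Fin 4) (Fin 4) ℝ := Matrix.of fun m j =>
    (μ x)⁻¹ * eps m * pd j (F m) x * eps j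
  have hAB : A * B = 1 := by
    ext i j
    have h := hF.conformal x hx i j
    rw [Matrix.mul_apply, Matrix.one_apply]
    have : ∑ m, A i m * B m j =
        (μ x)⁻¹ * eps j * ∑ m, eps m * (pd i (F m) x * pd j (F m) x) := by
      rw [Finset.mul_sum]
      exact Finset.sum_congr rfl fun m _ => by simp only [A, B, Matrix.of_apply]; ring
    rw [this, h, eta]
    split_ifs with hij
    · subst hij
      field_simp
      rw [sq, eps_mul_self]
    · simp
  have hBA' : B * A = 1 := mul_eq_one_comm.1 hAB
  have hBA : (B * A) m n = (1 : Matrix (Fin 4) (Fin 4) ℝ) m n := by rw [hBA']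
  rw [Matrix.mul_apply, Matrix.one_apply] at hBA
  have : ∑ i, B m i * A i n =
      (μ x)⁻¹ * eps m * ∑ i, eps i * (pd i (F m) x * pd i (F n) x) := by
    rw [Finset.mul_sum]
    exact Finset.sum_congr rfl fun i _ => by simp only [A, B, Matrix.of_apply]; ring
  rw [this] at hBA
  have e : ∑ i, eps i * (pd i (F m) x * pd i (F n) x) =
      μ x * eps m * ((μ x)⁻¹ * eps m * ∑ i, eps i * (pd i (F m) x * pd i (F n) x)) := by
    field_simp
    rw [sq, eps_mul_self, mul_one]
  rw [e, hBA, eta]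
  split_ifs <;> simp

/-- Parseval's identity for the orthogonal frame `∂ₖF`. -/
theorem parseval (hF : IsFlatConformal F μ W) (hx : x ∈ W) (X Y : Fin 4 → ℝ) :
    μ x * ∑ m, eps m * (X m * Y m) =
      ∑ k, eps k * ((∑ m, eps m * (X m * pd k (F m) x)) *
        ∑ m, eps m * (Y m * pd k (F m) x)) := by
  have h : ∀ k, eps k * ((∑ m, eps m * (X m * pd k (F m) x)) *
      ∑ m, eps m * (Y m * pd k (F m) x)) =
      ∑ m, ∑ n, eps m * X m * (eps n * Y n) * (eps k * (pd k (F m) x * pd k (F n) x)) := by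
    intro k
    rw [Finset.sum_mul_sum, Finset.mul_sum]
    refine Finset.sum_congr rfl fun m _ => ?_
    rw [Finset.mul_sum]
    exact Finset.sum_congr rfl fun n _ => by ring
  simp only [h]
  rw [Finset.sum_comm, Finset.mul_sum]
  refine Finset.sum_congr rfl fun m _ => ?_
  rw [Finset.sum_comm]
  simp only [← Finset.mul_sum, hF.dual hx, eta]
  simp only [mul_ite, mul_zero, Finset.sum_ite_eq, Finset.mem_univ, if_true]
  linear_combination -(X m * Y m * μ x * eps m) * eps_mul_self m

/-- A conformal factor `μ` of a map of flat 4-space satisfies `2 μ □μ = |∇μ|²`: this is the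
vanishing of the scalar curvature of the pulled back metric. -/
theorem box_factor (hF : IsFlatConformal F μ W) (hx : x ∈ W) :
    2 * (μ x * box μ x) = ∑ i, eps i * (pd i μ x * pd i μ x) := by
  have hμd : ∀ k, DifferentiableAt ℝ (pd k μ) x := fun k =>
    (hF.contDiffAt_factor hx).differentiableAt_pd
  have hbox : ∀ m, DifferentiableAt ℝ (box (F m)) x := fun m =>
    DifferentiableAt.fun_sum fun i _ => (hF.differentiableAt_pd_pd hx i i m).const_mul _
  have hpdbox : ∀ i m, pd i (box (F m)) x = ∑ k, eps k * pd k (pd k (pd i (F m))) x := by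
    intro i m
    change pd i (fun y => ∑ k, eps k * pd k (pd k (F m)) y) x = _
    rw [pd_sum fun k _ => (hF.differentiableAt_pd_pd hx k k m).const_mul _]
    refine Finset.sum_congr rfl fun k _ => ?_
    rw [pd_const_mul _ (hF.differentiableAt_pd_pd hx k k m), pd_comm (hF.contDiffAt_pd hx k m)]
    congr 1
    refine pd_congr ?_
    filter_upwards [hF.isOpen.mem_nhds hx] with y hy
    exact pd_comm (hF.contDiffAt_two hy m)
  -- the divergence of `box_inner`
  have h1 : ∀ j, ∑ m, eps m * (pd j (box (F m)) x * pd j (F m) x) +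
      ∑ m, eps m * (box (F m) x * pd j (pd j (F m)) x) = -pd j (pd j μ) x := by
    intro j
    have e : (fun y => ∑ m, eps m * (box (F m) y * pd j (F m) y)) =ᶠ[𝓝 x]
        fun y => -1 * pd j μ y := by
      filter_upwards [hF.isOpen.mem_nhds hx] with y hy
      rw [hF.box_inner hy, neg_one_mul]
    have h := pd_congr (j := j) e
    rw [pd_const_mul _ (hμd j), pd_sum fun m _ => ((hbox m).fun_mul
      (hF.differentiableAt_pd hx j m)).const_mul _, neg_one_mul] at h
    rw [← h, ← Finset.sum_add_distrib]
    refine Finset.sum_congr rfl fun m _ => ?_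
    rw [pd_const_mul _ ((hbox m).fun_mul (hF.differentiableAt_pd hx j m)),
      pd_mul (hbox m) (hF.differentiableAt_pd hx j m)]
    ring
  -- the second derivatives of `⟨∂ᵢF, ∂ᵢF⟩ = μ ηᵢᵢ`
  have h2 : ∀ k i, 2 * (∑ m, eps m * (pd k (pd k (pd i (F m))) x * pd i (F m) x) +
      ∑ m, eps m * (pd k (pd i (F m)) x * pd k (pd i (F m)) x)) = pd k (pd k μ) x * eps i := by
    intro k i
    have e : (fun y => ∑ m, eps m * (pd k (pd i (F m)) y * pd i (F m) y)) =ᶠ[𝓝 x]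
        fun y => (1 / 2 * eps i) * pd k μ y := by
      filter_upwards [hF.isOpen.mem_nhds hx] with y hy
      rw [hF.hessian_inner hy, eta_comm k i, eta, if_pos rfl]
      ring
    have h := pd_congr (j := k) e
    rw [pd_const_mul _ (hμd k), pd_sum fun m _ => ((hF.differentiableAt_pd_pd hx k i m).fun_mul
      (hF.differentiableAt_pd hx i m)).const_mul _] at h
    have h' : pd k (pd k μ) x * eps i = 2 * (1 / 2 * eps i * pd k (pd k μ) x) := by ring
    rw [h', ← h, ← Finset.sum_add_distrib]
    congr 1
    refine Finset.sum_congr rfl fun m _ => ?_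
    rw [pd_const_mul _ ((hF.differentiableAt_pd_pd hx k i m).fun_mul
      (hF.differentiableAt_pd hx i m)),
      pd_mul (hF.differentiableAt_pd_pd hx k i m) (hF.differentiableAt_pd hx i m)]
    ring
  have h3 : ∑ j, eps j * ∑ m, eps m * (pd j (box (F m)) x * pd j (F m) x) +
      ∑ m, eps m * (box (F m) x * box (F m) x) = -box μ x := by
    have e : ∑ m, eps m * (box (F m) x * box (F m) x) =
        ∑ j, eps j * ∑ m, eps m * (box (F m) x * pd j (pd j (F m)) x) := by
      conv_lhs => enter [2, m, 2, 2]; rw [box]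
      simp only [Finset.mul_sum]
      rw [Finset.sum_comm]
      exact Finset.sum_congr rfl fun j _ => Finset.sum_congr rfl fun m _ => by ring
    rw [e, ← Finset.sum_add_distrib]
    simp only [← mul_add, h1]
    simp [box]
  have h4 : 2 * (∑ i, eps i * ∑ m, eps m * (pd i (box (F m)) x * pd i (F m) x) +
      ∑ i, ∑ k, eps i * eps k *
        ∑ m, eps m * (pd k (pd i (F m)) x * pd k (pd i (F m)) x)) = 4 * box μ x := by
    have e : ∀ i, ∑ m, eps m * (pd i (box (F m)) x * pd i (F m) x) =
        ∑ k, eps k * ∑ m, eps m * (pd k (pd k (pd i (F m))) x * pd i (F m) x) := by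
      intro i
      simp only [hpdbox, Finset.sum_mul, Finset.mul_sum]
      rw [Finset.sum_comm]
      exact Finset.sum_congr rfl fun k _ => Finset.sum_congr rfl fun m _ => by ring
    have e2 : 4 * box μ x = ∑ i, ∑ k, eps i * eps k * (pd k (pd k μ) x * eps i) := by
      simp [box, Fin.sum_univ_four, eps]
      ring
    rw [e2]
    simp only [← h2, e]
    simp only [Finset.mul_sum, mul_add, Finset.sum_add_distrib]
    congr 1 <;> refine Finset.sum_congr rfl fun i _ => Finset.sum_congr rfl fun k _ =>
      Finset.sum_congr rfl fun m _ => by ring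
  have h5 := hF.parseval hx (fun m => box (F m) x) (fun m => box (F m) x)
  simp only [hF.box_inner hx] at h5
  have h6 : ∀ i k, μ x * ∑ m, eps m * (pd k (pd i (F m)) x * pd k (pd i (F m)) x) = _ :=
    fun i k => hF.parseval hx (fun m => pd k (pd i (F m)) x) (fun m => pd k (pd i (F m)) x)
  simp only [hF.hessian_inner hx] at h6
  have h7 : 2 * (μ x * ∑ i, ∑ k, eps i * eps k *
      ∑ m, eps m * (pd k (pd i (F m)) x * pd k (pd i (F m)) x)) =
      5 * ∑ i, eps i * (pd i μ x * pd i μ x) := by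
    have e : μ x * ∑ i, ∑ k, eps i * eps k *
        ∑ m, eps m * (pd k (pd i (F m)) x * pd k (pd i (F m)) x) =
        ∑ i, ∑ k, eps i * eps k * (μ x *
          ∑ m, eps m * (pd k (pd i (F m)) x * pd k (pd i (F m)) x)) := by
      simp only [Finset.mul_sum]
      refine Finset.sum_congr rfl fun i _ => Finset.sum_congr rfl fun k _ =>
        Finset.sum_congr rfl fun m _ => by ring
    rw [e]
    simp only [h6]
    simp [Fin.sum_univ_four, eta, eps]
    ring
  have h5' : μ x * ∑ m, eps m * (box (F m) x * box (F m) x) =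
      ∑ i, eps i * (pd i μ x * pd i μ x) := by
    rw [h5]; exact Finset.sum_congr rfl fun i _ => by ring
  linear_combination (1 / 3) * μ x * (2 * h3 - h4) + (1 / 3) * h7 - (2 / 3) * h5'

end IsFlatConformal

/-! ### Conformal covariance of the wave operator -/

section Covariance

variable {W : Set R4} {x : R4}

/-- Composing a solution of the ultra-hyperbolic equation with a conformal map gives a solution of
the Laplace equation of the pulled back metric. -/
theorem IsFlatConformal.box_comp {φ : R4 → R4} {μ u : R4 → ℝ}
    (hF : IsFlatConformal (fun m y => φ y m) μ W) (hφ : ContDiffOn ℝ 3 φ W) (hx : x ∈ W)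
    (hu : ContDiff ℝ 2 u) (hbox : box u (φ x) = 0) :
    μ x * box (fun y => u (φ y)) x + ∑ i, eps i * (pd i μ x * pd i (fun y => u (φ y)) x) = 0 := by
  have hφx : ∀ y ∈ W, DifferentiableAt ℝ φ y := fun y hy =>
    (hφ.contDiffAt (hF.isOpen.mem_nhds hy)).differentiableAt (by norm_num)
  have hud : Differentiable ℝ u := hu.differentiable (by norm_num)
  have hupd : ∀ m y, DifferentiableAt ℝ (pd m u) y := fun m y =>
    hu.contDiffAt.differentiableAt_pd
  have hcomp : ∀ m, DifferentiableAt ℝ (fun y => pd m u (φ y)) x := fun m =>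
    (hupd m _).comp x (hφx x hx)
  have h1 : ∀ i, pd i (pd i fun y => u (φ y)) x =
      ∑ m, (pd i (fun y => φ y m) x * ∑ n, pd i (fun y => φ y n) x * pd n (pd m u) (φ x)) +
        ∑ m, pd i (pd i fun y => φ y m) x * pd m u (φ x) := by
    intro i
    have e : pd i (fun y => u (φ y)) =ᶠ[𝓝 x]
        fun y => ∑ m, pd i (fun y => φ y m) y * pd m u (φ y) := by
      filter_upwards [hF.isOpen.mem_nhds hx] with y hy
      exact pd_comp (hud _) (hφx y hy)
    rw [pd_congr e, pd_sum fun m _ => (hF.differentiableAt_pd hx i m).fun_mul (hcomp m),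
      ← Finset.sum_add_distrib]
    refine Finset.sum_congr rfl fun m _ => ?_
    rw [pd_mul (hF.differentiableAt_pd hx i m) (hcomp m), pd_comp (hupd m _) (hφx x hx)]
  have h2 : box (fun y => u (φ y)) x =
      ∑ m, ∑ n, pd n (pd m u) (φ x) *
          ∑ i, eps i * (pd i (fun y => φ y m) x * pd i (fun y => φ y n) x) +
        ∑ m, box (fun y => φ y m) x * pd m u (φ x) := by
    simp only [box, h1, mul_add, Finset.sum_add_distrib, Finset.mul_sum, Finset.sum_mul]
    congr 1
    · rw [Finset.sum_comm]
      refine Finset.sum_congr rfl fun m _ => ?_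
      rw [Finset.sum_comm]
      exact Finset.sum_congr rfl fun n _ => Finset.sum_congr rfl fun i _ => by ring
    · rw [Finset.sum_comm]
      exact Finset.sum_congr rfl fun m _ => Finset.sum_congr rfl fun i _ => by ring
  have h3 : ∑ m, ∑ n, pd n (pd m u) (φ x) *
      ∑ i, eps i * (pd i (fun y => φ y m) x * pd i (fun y => φ y n) x) =
      μ x * box u (φ x) := by
    simp only [fun m n => hF.dual hx m n, eta, box, Finset.mul_sum]
    refine Finset.sum_congr rfl fun m _ => ?_
    simp only [mul_ite, mul_zero, Finset.sum_ite_eq, Finset.mem_univ, if_true]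
    ring
  have h4 : ∀ X : Fin 4 → ℝ, μ x * ∑ m, box (fun y => φ y m) x * X m =
      -∑ i, eps i * (pd i μ x * ∑ m, pd i (fun y => φ y m) x * X m) := by
    intro X
    have h := hF.parseval hx (fun m => box (fun y => φ y m) x) (fun m => eps m * X m)
    simp only [hF.box_inner hx] at h
    have e1 : ∀ a b : Fin 4 → ℝ, ∑ m, eps m * (a m * (eps m * b m)) = ∑ m, a m * b m :=
      fun a b => Finset.sum_congr rfl fun m _ => by
        linear_combination a m * b m * eps_mul_self m
    rw [e1 (fun m => box (fun y => φ y m) x) X] at h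
    rw [h, ← Finset.sum_neg_distrib]
    refine Finset.sum_congr rfl fun k _ => ?_
    have e2 : ∑ m, eps m * (eps m * X m * pd k (fun y => φ y m) x) =
        ∑ m, pd k (fun y => φ y m) x * X m := Finset.sum_congr rfl fun m _ => by
      linear_combination X m * pd k (fun y => φ y m) x * eps_mul_self m
    rw [e2]
    ring
  rw [h2, h3, hbox, mul_zero, zero_add, h4]
  simp only [fun i => pd_comp (j := i) (hud (φ x)) (hφx x hx)]
  ring

/-- Near a point where `μ ≠ 0`, `μ = σ √|μ| ^ 2` for a constant sign `σ`, and `√|μ|` is as smooth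
as `μ`. -/
theorem sqrt_abs_local {μ : R4 → ℝ} (hμ : ContDiffAt ℝ 2 μ x) (h0 : μ x ≠ 0) :
    ContDiffAt ℝ 2 (fun y => √|μ y|) x ∧
      ∃ σ : ℝ, σ ≠ 0 ∧ μ =ᶠ[𝓝 x] fun y => σ * (√|μ y| * √|μ y|) := by
  refine ⟨(hμ.abs h0).sqrt (abs_ne_zero.2 h0), ?_⟩
  simp only [Real.mul_self_sqrt (abs_nonneg _)]
  rcases lt_or_gt_of_ne h0 with h | h
  · refine ⟨-1, by norm_num, ?_⟩
    filter_upwards [hμ.continuousAt.eventually_lt continuousAt_const h] with y hy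
    rw [abs_of_neg hy]; ring
  · refine ⟨1, by norm_num, ?_⟩
    filter_upwards [continuousAt_const.eventually_lt hμ.continuousAt h] with y hy
    rw [abs_of_pos hy]; ring

theorem pd_sq_factor {Ω μ : R4 → ℝ} {σ : ℝ} (hΩ : ContDiffAt ℝ 2 Ω x)
    (e : μ =ᶠ[𝓝 x] fun y => σ * (Ω y * Ω y)) (i : Fin 4) :
    pd i μ x = σ * (2 * (Ω x * pd i Ω x)) := by
  have hd := hΩ.differentiableAt (by norm_num)
  rw [pd_congr e, pd_const_mul _ (hd.fun_mul hd), pd_mul hd hd]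
  ring

/-- If `√|μ|` is a solution of the ultra-hyperbolic equation and `w` is a solution of the Laplace
equation of `μ η`, then `√|μ| w` is a solution of the ultra-hyperbolic equation. -/
theorem box_sqrt_mul {μ w : R4 → ℝ} (hμ : ContDiffAt ℝ 2 μ x) (h0 : μ x ≠ 0)
    (hbox : box (fun y => √|μ y|) x = 0) (hw : ContDiffAt ℝ 2 w x)
    (h : μ x * box w x + ∑ i, eps i * (pd i μ x * pd i w x) = 0) :
    box (fun y => √|μ y| * w y) x = 0 := by
  obtain ⟨hΩ, σ, hσ, e⟩ := sqrt_abs_local hμ h0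
  have hΩ0 : √|μ x| ≠ 0 := (Real.sqrt_pos.2 (abs_pos.2 h0)).ne'
  rw [box_mul hΩ hw, hbox]
  have hs : ∑ i, eps i * (pd i μ x * pd i w x) = σ * (2 * √|μ x|) *
      ∑ i, eps i * (pd i (fun y => √|μ y|) x * pd i w x) := by
    rw [Finset.mul_sum]
    exact Finset.sum_congr rfl fun i _ => by rw [pd_sq_factor hΩ e]; ring
  have hμx : μ x = σ * (√|μ x| * √|μ x|) := e.eq_of_nhds
  apply mul_left_cancel₀ (mul_ne_zero hσ hΩ0)
  linear_combination h - hs - box w x * hμx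

/-- The square root of the conformal factor of a conformal map solves the ultra-hyperbolic
equation. -/
theorem IsFlatConformal.box_sqrt_factor {F : Fin 4 → R4 → ℝ} {μ : R4 → ℝ}
    (hF : IsFlatConformal F μ W) (hx : x ∈ W) : box (fun y => √|μ y|) x = 0 := by
  have hμ := hF.contDiffAt_factor hx
  have h0 := hF.ne_zero x hx
  obtain ⟨hΩ, σ, hσ, e⟩ := sqrt_abs_local hμ h0
  have hΩ0 : √|μ x| ≠ 0 := (Real.sqrt_pos.2 (abs_pos.2 h0)).ne'
  have h := hF.box_factor hx
  have hb : box μ x = σ * (2 * (√|μ x| * box (fun y => √|μ y|) x) +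
      2 * ∑ i, eps i * (pd i (fun y => √|μ y|) x * pd i (fun y => √|μ y|) x)) := by
    have h1 : box μ x = σ * box (fun y => √|μ y| * √|μ y|) x := by
      rw [box_congr e, box_mul contDiffAt_const (hΩ.mul hΩ)]
      simp [box, pd_const]
    rw [h1, box_mul hΩ hΩ]
    ring
  simp only [pd_sq_factor hΩ e] at h
  rw [hb] at h
  have hs : ∑ i, eps i * (σ * (2 * (√|μ x| * pd i (fun y => √|μ y|) x)) *
      (σ * (2 * (√|μ x| * pd i (fun y => √|μ y|) x)))) = 4 * σ * (σ * (√|μ x| * √|μ x|)) *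
        ∑ i, eps i * (pd i (fun y => √|μ y|) x * pd i (fun y => √|μ y|) x) := by
    rw [Finset.mul_sum]
    exact Finset.sum_congr rfl fun i _ => by ring
  rw [hs, ← e.eq_of_nhds] at h
  have h2 : (4 * μ x * σ * √|μ x|) * box (fun y => √|μ y|) x = 0 := by linarith
  exact (mul_eq_zero.1 h2).resolve_left (by positivity)

/-- Conformal covariance of the ultra-hyperbolic operator: if `φ` is conformal with factor `μ`, then
`√|μ| (u ∘ φ)` solves the ultra-hyperbolic equation whenever `u` does. -/
theorem IsFlatConformal.box_sqrt_mul_comp {φ : R4 → R4} {μ u : R4 → ℝ}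
    (hF : IsFlatConformal (fun m y => φ y m) μ W) (hφ : ContDiffOn ℝ 3 φ W) (hx : x ∈ W)
    (hu : ContDiff ℝ 2 u) (hbox : box u (φ x) = 0) :
    box (fun y => √|μ y| * u (φ y)) x = 0 :=
  box_sqrt_mul (hF.contDiffAt_factor hx) (hF.ne_zero x hx) (hF.box_sqrt_factor hx)
    (hu.contDiffAt.comp x ((hφ.contDiffAt (hF.isOpen.mem_nhds hx)).of_le (by norm_num)))
    (hF.box_comp hφ hx hu hbox)

/-- In coordinates in which the metric is `μ η`, the Laplace equation reads
`μ □w + ⟨∇μ, ∇w⟩ = 0`. -/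
theorem box_of_coordLaplacian {h : R4 → Matrix (Fin 4) (Fin 4) ℝ} {μ w : R4 → ℝ}
    (hμ : DifferentiableAt ℝ μ x) (h0 : μ x ≠ 0)
    (hh : ∀ᶠ y in 𝓝 x, h y = Matrix.of fun j k => μ y * eta j k)
    (hw : coordLaplacian h w x = 0) :
    μ x * box w x + ∑ i, eps i * (pd i μ x * pd i w x) = 0 := by
  have hpd : ∀ i j k, pd i (fun y => h y j k) x = eta j k * pd i μ x := by
    intro i j k
    rw [← pd_const_mul _ hμ]
    refine pd_congr ?_
    filter_upwards [hh] with y hy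
    rw [hy, Matrix.of_apply, mul_comm]
  have hinv : (h x)⁻¹ = Matrix.of fun j k => (μ x)⁻¹ * eta j k := by
    refine Matrix.inv_eq_right_inv ?_
    rw [hh.self_of_nhds]
    ext j k
    rw [Matrix.mul_apply, Matrix.one_apply]
    simp only [Matrix.of_apply, eta]
    rw [Finset.sum_eq_single j (fun m _ hm => by simp [Ne.symm hm]) (by simp), if_pos rfl]
    split_ifs with hjk
    · field_simp
      rw [sq, eps_mul_self]
    · simp
  have e : coordLaplacian h w x * μ x ^ 2 =
      μ x * box w x + ∑ i, eps i * (pd i μ x * pd i w x) := by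
    simp only [coordLaplacian, christoffel, hpd, hinv, Matrix.of_apply, box]
    simp [Fin.sum_univ_four, eta, eps]
    field_simp
    ring
  rw [← e, hw, zero_mul]

end Covariance

/-! ### A Goursat problem on a triangle -/

/-- Fubini's theorem on the triangle `0 ≤ b ≤ a ≤ 1`. -/
theorem integral_triangle_swap {f : ℝ × ℝ → ℝ} (hf : Continuous f) :
    ∫ a in (0 : ℝ)..1, ∫ b in (0 : ℝ)..a, f (a, b) =
      ∫ b in (0 : ℝ)..1, ∫ a in b..1, f (a, b) := by
  have hT : MeasurableSet {z : ℝ × ℝ | z.2 ≤ z.1} :=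
    (isClosed_le continuous_snd continuous_fst).measurableSet
  let g : ℝ → ℝ → ℝ := fun a b => Set.indicator {z : ℝ × ℝ | z.2 ≤ z.1} f (a, b)
  have h1 : ∀ a ∈ Set.uIoc (0 : ℝ) 1, ∫ b in (0 : ℝ)..1, g a b = ∫ b in (0 : ℝ)..a, f (a, b) := by
    intro a ha
    rw [Set.uIoc_of_le zero_le_one] at ha
    rw [← intervalIntegral.integral_indicator (a₂ := a) ⟨ha.1.le, ha.2⟩]
    rfl
  have h2 : ∀ b ∈ Set.uIoc (0 : ℝ) 1, ∫ a in (0 : ℝ)..1, g a b = ∫ a in b..1, f (a, b) := by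
    intro b hb
    rw [Set.uIoc_of_le zero_le_one] at hb
    have e : (fun a => g a b) = Set.indicator (Set.Ici b) fun a => f (a, b) := rfl
    rw [e, intervalIntegral.integral_of_le zero_le_one, intervalIntegral.integral_of_le hb.2,
      setIntegral_indicator measurableSet_Ici, ← integral_Icc_eq_integral_Ioc]
    congr 2
    ext a
    simp only [Set.mem_inter_iff, Set.mem_Ioc, Set.mem_Ici, Set.mem_Icc]
    exact ⟨fun h => ⟨h.2, h.1.2⟩, fun h => ⟨⟨hb.1.trans_le h.1, h.2⟩, h.1⟩⟩
  have hint : IntegrableOn (Function.uncurry g) (Set.uIoc (0 : ℝ) 1 ×ˢ Set.uIoc (0 : ℝ) 1) := by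
    have : IntegrableOn f (Set.uIcc (0 : ℝ) 1 ×ˢ Set.uIcc (0 : ℝ) 1) :=
      hf.continuousOn.integrableOn_compact (isCompact_uIcc.prod isCompact_uIcc)
    exact (this.mono_set (Set.prod_mono Set.uIoc_subset_uIcc Set.uIoc_subset_uIcc)).indicator hT
  have hswap := intervalIntegral_intervalIntegral_swap hint
  rw [intervalIntegral.integral_congr_ae (g := fun a => ∫ b in (0 : ℝ)..a, f (a, b))
      (Filter.Eventually.of_forall h1),
    intervalIntegral.integral_congr_ae (g := fun b => ∫ a in b..1, f (a, b))
      (Filter.Eventually.of_forall h2)] at hswap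
  exact hswap

section Goursat

variable {N : ℝ × ℝ → ℝ}

theorem hasDerivAt_fst {f : ℝ × ℝ → ℝ} (hf : Differentiable ℝ f) (a b : ℝ) :
    HasDerivAt (fun a => f (a, b)) (fderiv ℝ f (a, b) (1, 0)) a :=
  (hf (a, b)).hasFDerivAt.comp_hasDerivAt a ((hasDerivAt_id a).prodMk (hasDerivAt_const a b))

theorem hasDerivAt_snd {f : ℝ × ℝ → ℝ} (hf : Differentiable ℝ f) (a b : ℝ) :
    HasDerivAt (fun b => f (a, b)) (fderiv ℝ f (a, b) (0, 1)) b :=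
  (hf (a, b)).hasFDerivAt.comp_hasDerivAt b ((hasDerivAt_const b a).prodMk (hasDerivAt_id b))

/-- Uniqueness for a singular Goursat problem.  In the characteristic coordinates `a = r + s`,
`b = r - s` the equation says that `N` solves `N_rr + N_r / r = N_ss + N_s / s`.  The energy
identity with multiplier `s N_r` on the triangle `0 ≤ b ≤ a ≤ 1` has no contribution from the side
`b = 0`, where `N` vanishes, nor from the axis `s = 0`, and forces `N` to be constant on the
side `a = 1`. -/
theorem goursat_eq_zero (hN : ContDiff ℝ 2 N) (h0 : ∀ a, N (a, 0) = 0)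
    (heq : ∀ a b, 0 ≤ b → b ≤ a → a ≤ 1 →
      (a ^ 2 - b ^ 2) * fderiv ℝ (fun z => fderiv ℝ N z (1, 0)) (a, b) (0, 1) +
        a * fderiv ℝ N (a, b) (0, 1) - b * fderiv ℝ N (a, b) (1, 0) = 0) :
    N (1, 1) = 0 := by
  set Na : ℝ × ℝ → ℝ := fun z => fderiv ℝ N z (1, 0) with hNa
  set Nb : ℝ × ℝ → ℝ := fun z => fderiv ℝ N z (0, 1) with hNb
  have hNd : Differentiable ℝ N := hN.differentiable (by norm_num)
  have hN' : ContDiff ℝ 1 (fderiv ℝ N) := hN.fderiv_right (by norm_num)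
  have cNa : ContDiff ℝ 1 Na := hN'.clm_apply contDiff_const
  have cNb : ContDiff ℝ 1 Nb := hN'.clm_apply contDiff_const
  have dNa : Differentiable ℝ Na := cNa.differentiable (by norm_num)
  have dNb : Differentiable ℝ Nb := cNb.differentiable (by norm_num)
  set Nab : ℝ × ℝ → ℝ := fun z => fderiv ℝ Na z (0, 1) with hNab
  have cNab : Continuous Nab := (cNa.continuous_fderiv (by norm_num)).clm_apply continuous_const
  have hsymm : ∀ z, fderiv ℝ Nb z (1, 0) = Nab z := by
    intro z
    have hd : DifferentiableAt ℝ (fderiv ℝ N) z := hN'.differentiable (by norm_num) z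
    have e : ∀ v w : ℝ × ℝ, fderiv ℝ (fun z => fderiv ℝ N z v) z w =
        fderiv ℝ (fderiv ℝ N) z w v := by
      intro v w
      rw [fderiv_clm_apply hd (by fun_prop)]
      simp
    rw [hNb, hNab, hNa]
    simp only [e]
    exact (hN.contDiffAt.isSymmSndFDerivAt (by simp)).eq _ _
  have hNa0 : ∀ a, Na (a, 0) = 0 := fun a =>
    (hasDerivAt_fst hNd a 0).unique ((hasDerivAt_const a (0 : ℝ)).congr_of_eventuallyEq
      (Filter.Eventually.of_forall h0))
  let P : ℝ × ℝ → ℝ := fun z => -Na z ^ 2 + 2 * (z.1 - z.2) * (Na z * Nab z)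
  let Q : ℝ × ℝ → ℝ := fun z => Nb z ^ 2 + 2 * (z.1 - z.2) * (Nb z * Nab z)
  have cP : Continuous P := by
    have := cNa.continuous
    fun_prop
  have cQ : Continuous Q := by
    have := cNb.continuous
    fun_prop
  have hP : ∀ a, ∫ b in (0 : ℝ)..a, P (a, b) = 0 := by
    intro a
    have hd : ∀ b ∈ Set.uIcc 0 a, HasDerivAt (fun b => (a - b) * Na (a, b) ^ 2) (P (a, b)) b := by
      intro b _
      convert! ((hasDerivAt_id b).const_sub a).mul ((hasDerivAt_snd dNa a b).fun_pow 2) using 1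
      simp only [P, hNab, id]
      push_cast
      ring
    rw [intervalIntegral.integral_eq_sub_of_hasDerivAt hd
      ((cP.comp (by fun_prop : Continuous fun b : ℝ => (a, b))).intervalIntegrable _ _), hNa0]
    ring
  have hQ : ∀ b, ∫ a in b..1, Q (a, b) = (1 - b) * Nb (1, b) ^ 2 := by
    intro b
    have hd : ∀ a ∈ Set.uIcc b 1, HasDerivAt (fun a => (a - b) * Nb (a, b) ^ 2) (Q (a, b)) a := by
      intro a _
      convert! ((hasDerivAt_id a).sub_const b).mul ((hasDerivAt_fst dNb a b).fun_pow 2) using 1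
      simp only [Q, hsymm, id]
      push_cast
      ring
    rw [intervalIntegral.integral_eq_sub_of_hasDerivAt hd
      ((cQ.comp (by fun_prop : Continuous fun a : ℝ => (a, b))).intervalIntegrable _ _)]
    ring
  have hPQ : ∀ a b, 0 < a → 0 ≤ b → b ≤ a → a ≤ 1 → P (a, b) + Q (a, b) ≤ 0 := by
    intro a b ha hb hba ha1
    have h := heq a b hb hba ha1
    have hs : 0 < a + b := by linarith
    have e : (a + b) * (P (a, b) + Q (a, b)) = -((a - b) * (Na (a, b) + Nb (a, b)) ^ 2) := by
      simp only [P, Q]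
      linear_combination 2 * (Na (a, b) + Nb (a, b)) * h
    have : (a + b) * (P (a, b) + Q (a, b)) ≤ 0 := by
      rw [e]
      exact neg_nonpos.2 (mul_nonneg (by linarith) (sq_nonneg _))
    exact nonpos_of_mul_nonpos_right this hs
  have hle : ∫ b in (0 : ℝ)..1, (1 - b) * Nb (1, b) ^ 2 ≤ 0 := by
    simp only [← hQ]
    rw [← integral_triangle_swap cQ, ← neg_nonneg, ← intervalIntegral.integral_neg]
    refine intervalIntegral.integral_nonneg zero_le_one fun a ha => ?_
    rcases ha.1.eq_or_lt with rfl | hpos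
    · simp
    have i1 : IntervalIntegrable (fun b => P (a, b)) volume 0 a :=
      (cP.comp (by fun_prop : Continuous fun b : ℝ => (a, b))).intervalIntegrable _ _
    have i2 : IntervalIntegrable (fun b => Q (a, b)) volume 0 a :=
      (cQ.comp (by fun_prop : Continuous fun b : ℝ => (a, b))).intervalIntegrable _ _
    have e : ∫ b in (0 : ℝ)..a, Q (a, b) = ∫ b in (0 : ℝ)..a, (P (a, b) + Q (a, b)) := by
      rw [intervalIntegral.integral_add i1 i2, hP, zero_add]
    rw [e, ← intervalIntegral.integral_neg]
    exact intervalIntegral.integral_nonneg ha.1 fun b hb =>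
      neg_nonneg.2 (hPQ a b hpos hb.1 hb.2 ha.2)
  have cF : Continuous fun b => (1 - b) * Nb (1, b) ^ 2 := by
    have := cNb.continuous
    fun_prop
  have hNb1 : ∀ b ∈ Set.Ico (0 : ℝ) 1, Nb (1, b) = 0 := by
    intro b hb
    by_contra hne
    refine hle.not_gt (intervalIntegral.integral_pos zero_lt_one cF.continuousOn
      (fun c hc => mul_nonneg (by linarith [hc.2]) (sq_nonneg _)) ⟨b, ⟨hb.1, hb.2.le⟩, ?_⟩)
    exact mul_pos (by linarith [hb.2]) (by positivity)
  have hconst := constant_of_has_deriv_right_zero (f := fun b => N (1, b)) (a := 0) (b := 1)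
    (hN.continuous.comp (by fun_prop)).continuousOn
    (fun b hb => by
      have h := (hasDerivAt_snd hNd 1 b).hasDerivWithinAt (s := Set.Ici b)
      change HasDerivWithinAt _ (Nb (1, b)) _ _ at h
      rwa [hNb1 b hb] at h)
  have h1 := hconst 1 ⟨zero_le_one, le_rfl⟩
  simpa only [h0] using h1

end Goursat

/-! ### Smooth dependence of integrals on parameters -/

section ParametricIntegral

variable {E : Type} [NormedAddCommGroup E] [NormedSpace ℝ E] [ProperSpace E]

theorem hasFDerivAt_intervalIntegral {G : Type} [NormedAddCommGroup G] [NormedSpace ℝ G]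
    [CompleteSpace G] {F : E × ℝ → G} (hF : ContDiff ℝ 1 F) (a b : ℝ) (x : E) :
    HasFDerivAt (fun x => ∫ t in a..b, F (x, t))
      (∫ t in a..b, (fderiv ℝ F (x, t)).comp (ContinuousLinearMap.inl ℝ E ℝ)) x := by
  let F' : E → ℝ → E →L[ℝ] G := fun x t =>
    (fderiv ℝ F (x, t)).comp (ContinuousLinearMap.inl ℝ E ℝ)
  have hF' : Continuous (Function.uncurry F') := by
    have : Continuous (fderiv ℝ F) := hF.continuous_fderiv (by norm_num)
    change Continuous fun z : E × ℝ =>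
      (fderiv ℝ F (z.1, z.2)).comp (ContinuousLinearMap.inl ℝ E ℝ)
    fun_prop
  obtain ⟨C, hC⟩ := ((isCompact_closedBall x 1).prod (isCompact_uIcc (a := a) (b := b)))
    |>.exists_bound_of_continuousOn hF'.continuousOn
  refine intervalIntegral.hasFDerivAt_integral_of_dominated_of_fderiv_le (F := fun x t => F (x, t))
    (F' := F') (bound := fun _ => C) (Metric.closedBall_mem_nhds x one_pos) ?_ ?_ ?_ ?_ ?_ ?_
  · exact Filter.Eventually.of_forall fun y =>
      (hF.continuous.comp (by fun_prop : Continuous fun t : ℝ => (y, t))).aestronglyMeasurable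
  · exact (hF.continuous.comp (by fun_prop : Continuous fun t : ℝ => (x, t))).intervalIntegrable _ _
  · exact (hF'.comp (by fun_prop : Continuous fun t : ℝ => (x, t))).aestronglyMeasurable
  · exact Filter.Eventually.of_forall fun t ht y hy =>
      hC (y, t) ⟨hy, Set.uIoc_subset_uIcc ht⟩
  · exact intervalIntegrable_const
  · refine Filter.Eventually.of_forall fun t _ y _ => ?_
    have h1 : HasFDerivAt F (fderiv ℝ F (y, t)) (y, t) :=
      (hF.differentiable (by norm_num) (y, t)).hasFDerivAt
    exact h1.comp y (hasFDerivAt_prodMk_left y t)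

theorem contDiff_intervalIntegral (n : ℕ) {G : Type} [NormedAddCommGroup G] [NormedSpace ℝ G]
    [CompleteSpace G] {F : E × ℝ → G} (hF : ContDiff ℝ n F) (a b : ℝ) :
    ContDiff ℝ n (fun x => ∫ t in a..b, F (x, t)) := by
  induction n generalizing G with
  | zero =>
    have hc : Continuous F := hF.continuous
    exact contDiff_zero.2
      (intervalIntegral.continuous_parametric_intervalIntegral_of_continuous' (by fun_prop) a b)
  | succ n ih =>
    have h1 : ContDiff ℝ 1 F := hF.of_le (by exact_mod_cast Nat.le_add_left 1 n)
    push_cast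
    refine contDiff_succ_iff_fderiv.2
      ⟨fun x => (hasFDerivAt_intervalIntegral h1 a b x).differentiableAt, by simp, ?_⟩
    rw [funext fun x => (hasFDerivAt_intervalIntegral h1 a b x).fderiv]
    refine ih (F := fun z : E × ℝ => (fderiv ℝ F z).comp (ContinuousLinearMap.inl ℝ E ℝ)) ?_
    exact (hF.fderiv_right (by norm_cast)).clm_comp contDiff_const

end ParametricIntegral

theorem pd_intervalIntegral {F : R4 × ℝ → ℝ} (hF : ContDiff ℝ 1 F) (a b : ℝ) (j : Fin 4)
    (x : R4) :
    pd j (fun x => ∫ t in a..b, F (x, t)) x = ∫ t in a..b, pd j (fun y => F (y, t)) x := by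
  have hc : Continuous fun t : ℝ =>
      (fderiv ℝ F (x, t)).comp (ContinuousLinearMap.inl ℝ R4 ℝ) := by
    have : Continuous (fderiv ℝ F) := hF.continuous_fderiv (by norm_num)
    fun_prop
  rw [pd, (hasFDerivAt_intervalIntegral hF a b x).fderiv,
    ContinuousLinearMap.intervalIntegral_apply (hc.intervalIntegrable _ _)]
  refine intervalIntegral.integral_congr fun t _ => ?_
  have h1 : HasFDerivAt F (fderiv ℝ F (x, t)) (x, t) :=
    (hF.differentiable (by norm_num) (x, t)).hasFDerivAt
  have h2 : HasFDerivAt (fun y => F (y, t)) _ x := h1.comp x (hasFDerivAt_prodMk_left x t)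
  rw [pd, h2.fderiv]

theorem contDiff_pd_param {F : R4 × ℝ → ℝ} {m n : WithTop ℕ∞} (hF : ContDiff ℝ n F)
    (hmn : m + 1 ≤ n) (j : Fin 4) :
    ContDiff ℝ m (fun z : R4 × ℝ => pd j (fun y => F (y, z.2)) z.1) := by
  have e : (fun z : R4 × ℝ => pd j (fun y => F (y, z.2)) z.1) =
      fun z => fderiv ℝ F z (basisVec j, 0) := by
    funext z
    have h1 : HasFDerivAt F (fderiv ℝ F (z.1, z.2)) (z.1, z.2) :=
      (hF.differentiable (by rintro rfl; simp at hmn) (z.1, z.2)).hasFDerivAt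
    have h2 : HasFDerivAt (fun y => F (y, z.2)) _ z.1 :=
      h1.comp z.1 (hasFDerivAt_prodMk_left z.1 z.2)
    rw [pd, h2.fderiv]
    rfl
  rw [e]
  exact (hF.fderiv_right hmn).clm_apply contDiff_const

theorem box_intervalIntegral {F : R4 × ℝ → ℝ} (hF : ContDiff ℝ 2 F) (a b : ℝ) (x : R4) :
    box (fun x => ∫ t in a..b, F (x, t)) x = ∫ t in a..b, box (fun y => F (y, t)) x := by
  have h1 : ∀ j, ContDiff ℝ 1 (fun z : R4 × ℝ => pd j (fun y => F (y, z.2)) z.1) := fun j =>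
    contDiff_pd_param hF (by norm_num) j
  have h2 : ∀ j, Continuous (fun z : R4 × ℝ => pd j (pd j fun y => F (y, z.2)) z.1) := fun j =>
    (contDiff_pd_param (h1 j) (m := 0) (by norm_num) j).continuous
  have e : ∀ j, pd j (pd j fun x => ∫ t in a..b, F (x, t)) x =
      ∫ t in a..b, pd j (pd j fun y => F (y, t)) x := by
    intro j
    rw [funext fun y => pd_intervalIntegral (hF.of_le (by norm_num)) a b j y]
    exact pd_intervalIntegral (h1 j) a b j x
  simp only [box, e]
  rw [intervalIntegral.integral_finsetSum]
  · simp
  · intro j _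
    exact (((h2 j).comp (by fun_prop : Continuous fun t : ℝ => (x, t))).const_mul
      _).intervalIntegrable _ _

/-! ### Averages over rotations -/

/-- The rotation by the angle `α` in the `(x₁, x₂)`-plane and by `β` in the `(x₃, x₄)`-plane. -/
noncomputable def rot (α β : ℝ) (x : R4) : R4 :=
  !₂[Real.cos α * x 0 - Real.sin α * x 1, Real.sin α * x 0 + Real.cos α * x 1,
    Real.cos β * x 2 - Real.sin β * x 3, Real.sin β * x 2 + Real.cos β * x 3]

theorem rot_rot (α β γ δ : ℝ) (x : R4) : rot α β (rot γ δ x) = rot (α + γ) (β + δ) x := by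
  ext i
  fin_cases i <;> simp [rot, Real.cos_add, Real.sin_add] <;> ring

theorem contDiff_rot {E : Type*} [NormedAddCommGroup E] [NormedSpace ℝ E] {n : WithTop ℕ∞}
    {f g : E → ℝ} {h : E → R4} (hf : ContDiff ℝ n f) (hg : ContDiff ℝ n g) (hh : ContDiff ℝ n h) :
    ContDiff ℝ n fun z => rot (f z) (g z) (h z) := by
  have hc : ∀ i, ContDiff ℝ n fun z => h z i := fun i => contDiff_euclidean.1 hh i
  have h1 := Real.contDiff_cos.comp hf
  have h2 := Real.contDiff_sin.comp hf
  have h3 := Real.contDiff_cos.comp hg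
  have h4 := Real.contDiff_sin.comp hg
  refine contDiff_euclidean.2 fun i => ?_
  fin_cases i
  · exact (h1.mul (hc 0)).sub (h2.mul (hc 1))
  · exact (h2.mul (hc 0)).add (h1.mul (hc 1))
  · exact (h3.mul (hc 2)).sub (h4.mul (hc 3))
  · exact (h4.mul (hc 2)).add (h3.mul (hc 3))

theorem pd_linear (c : Fin 4 → ℝ) (j : Fin 4) (x : R4) :
    pd j (fun y => ∑ k, c k * y k) x = c j := by
  have hd : ∀ k, DifferentiableAt ℝ (fun y : R4 => y k) x := fun k => by fun_prop
  have h : ∀ k, pd j (fun y : R4 => y k) x = if k = j then 1 else 0 := fun k => by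
    rw [pd, ← fderiv_apply_coord (φ := fun y => y) differentiableAt_id, fderiv_fun_id]
    simp [basisVec]
  rw [pd_sum fun k _ => (hd k).const_mul _]
  simp [pd_const_mul _ (hd _), h]

theorem isFlatConformal_rot (α β : ℝ) :
    IsFlatConformal (fun m y => rot α β y m) (fun _ => 1) Set.univ where
  isOpen := isOpen_univ
  contDiffOn m :=
    (contDiff_euclidean.1 (contDiff_rot contDiff_const contDiff_const contDiff_id) m).contDiffOn
  ne_zero _ _ := one_ne_zero
  conformal y _ i j := by
    let c : Fin 4 → Fin 4 → ℝ := ![![Real.cos α, -Real.sin α, 0, 0],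
      ![Real.sin α, Real.cos α, 0, 0], ![0, 0, Real.cos β, -Real.sin β],
      ![0, 0, Real.sin β, Real.cos β]]
    have e : ∀ m, (fun y => rot α β y m) = fun y => ∑ k, c m k * y k := by
      intro m
      funext y
      fin_cases m <;> simp [rot, c, Fin.sum_univ_four] <;> ring
    have h1 := Real.sin_sq_add_cos_sq α
    have h2 := Real.sin_sq_add_cos_sq β
    simp only [e, pd_linear]
    fin_cases i <;> fin_cases j <;> simp [Fin.sum_univ_four, eta, eps, c] <;> linarith

theorem box_rot {w : R4 → ℝ} (hw : ContDiff ℝ 2 w) {α β : ℝ} {x : R4}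
    (h : box w (rot α β x) = 0) : box (fun y => w (rot α β y)) x = 0 := by
  have := (isFlatConformal_rot α β).box_comp (x := x)
    (contDiff_rot contDiff_const contDiff_const contDiff_id).contDiffOn trivial hw h
  simpa [pd_const] using this

/-- The average (up to normalisation) of a function over the rotations of `ℝ² × ℝ²`. -/
noncomputable def rotAverage (w : R4 → ℝ) (x : R4) : ℝ :=
  ∫ β in (0 : ℝ)..2 * Real.pi, ∫ α in (0 : ℝ)..2 * Real.pi, w (rot α β x)

section RotAverage

variable {w : R4 → ℝ}

theorem contDiff_rotAverage_integrand (hw : ContDiff ℝ 2 w) :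
    ContDiff ℝ 2 fun z : R4 × ℝ => ∫ α in (0 : ℝ)..2 * Real.pi, w (rot α z.2 z.1) :=
  contDiff_intervalIntegral 2 (F := fun p : (R4 × ℝ) × ℝ => w (rot p.2 p.1.2 p.1.1))
    (hw.comp (contDiff_rot (by fun_prop) (by fun_prop) (by fun_prop))) _ _

theorem contDiff_rotAverage (hw : ContDiff ℝ 2 w) : ContDiff ℝ 2 (rotAverage w) :=
  contDiff_intervalIntegral 2 (contDiff_rotAverage_integrand hw) _ _

theorem box_rotAverage (hw : ContDiff ℝ 2 w) {x : R4} (h : ∀ α β, box w (rot α β x) = 0) :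
    box (rotAverage w) x = 0 := by
  have h1 := box_intervalIntegral (contDiff_rotAverage_integrand hw) 0 (2 * Real.pi) x
  change box (rotAverage w) x = _ at h1
  rw [h1]
  refine intervalIntegral.integral_zero_ae (Filter.Eventually.of_forall fun β _ => ?_)
  have hF : ContDiff ℝ 2 fun z : R4 × ℝ => w (rot z.2 β z.1) :=
    hw.comp (contDiff_rot contDiff_snd contDiff_const contDiff_fst)
  change box (fun y => ∫ α in (0 : ℝ)..2 * Real.pi, w (rot α β y)) x = 0
  rw [box_intervalIntegral hF]
  exact intervalIntegral.integral_zero_ae (Filter.Eventually.of_forall fun α _ =>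
    box_rot hw (h α β))

theorem rotAverage_rot (w : R4 → ℝ) (γ δ : ℝ) (x : R4) :
    rotAverage w (rot γ δ x) = rotAverage w x := by
  have shift : ∀ (f : ℝ → ℝ) (c : ℝ), Function.Periodic f (2 * Real.pi) →
      ∫ t in (0 : ℝ)..2 * Real.pi, f (t + c) = ∫ t in (0 : ℝ)..2 * Real.pi, f t := by
    intro f c hf
    rw [intervalIntegral.integral_comp_add_right, zero_add, add_comm,
      hf.intervalIntegral_add_eq c 0, zero_add]
  simp only [rotAverage, rot_rot]
  have h1 : ∀ β, ∫ α in (0 : ℝ)..2 * Real.pi, w (rot (α + γ) (β + δ) x) =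
      ∫ α in (0 : ℝ)..2 * Real.pi, w (rot α (β + δ) x) := fun β =>
    shift (fun α => w (rot α (β + δ) x)) γ fun α => by simp [rot]
  simp only [h1]
  exact shift (fun β => ∫ α in (0 : ℝ)..2 * Real.pi, w (rot α β x)) δ fun β => by simp [rot]

end RotAverage

/-! ### Asgeirsson's mean value theorem -/

theorem hasDerivAt_of_coord {n : ℕ} {c : ℝ → EuclideanSpace ℝ (Fin n)}
    {v : EuclideanSpace ℝ (Fin n)} {t : ℝ} (h : ∀ i, HasDerivAt (fun s => c s i) (v i) t) :
    HasDerivAt c v t := by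
  have h' : HasDerivAt (fun s => (c s).ofLp) v.ofLp t := hasDerivAt_pi.2 h
  exact (PiLp.hasFDerivAt_toLp (𝕜 := ℝ) 2 (c t).ofLp).comp_hasDerivAt t h'

section Invariant

variable {W : R4 → ℝ}

/-- The angular derivatives of a rotation invariant function vanish. -/
theorem angular_deriv_of_invariant (hW : ContDiff ℝ 2 W)
    (hinv : ∀ γ δ x, W (rot γ δ x) = W x) (x : R4) :
    x 0 * pd 1 W x - x 1 * pd 0 W x = 0 ∧ x 2 * pd 3 W x - x 3 * pd 2 W x = 0 := by
  have hd : Differentiable ℝ W := hW.differentiable (by norm_num)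
  have key : ∀ p q : ℝ, ∑ j, (!₂[-p * x 1, p * x 0, -q * x 3, q * x 2] : R4) j * pd j W x = 0 := by
    intro p q
    have hrot : HasDerivAt (fun t : ℝ => rot (p * t) (q * t) x)
        (!₂[-p * x 1, p * x 0, -q * x 3, q * x 2] : R4) 0 := by
      have hc : ∀ p : ℝ, HasDerivAt (fun t : ℝ => Real.cos (p * t)) 0 0 := fun p => by
        simpa using ((hasDerivAt_id (0 : ℝ)).const_mul p).cos
      have hs : ∀ p : ℝ, HasDerivAt (fun t : ℝ => Real.sin (p * t)) p 0 := fun p => by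
        simpa using ((hasDerivAt_id (0 : ℝ)).const_mul p).sin
      refine hasDerivAt_of_coord fun i => ?_
      fin_cases i
      · simpa [rot] using ((hc p).mul_const (x 0)).fun_sub ((hs p).mul_const (x 1))
      · simpa [rot] using ((hs p).mul_const (x 0)).fun_add ((hc p).mul_const (x 1))
      · simpa [rot] using ((hc q).mul_const (x 2)).fun_sub ((hs q).mul_const (x 3))
      · simpa [rot] using ((hs q).mul_const (x 2)).fun_add ((hc q).mul_const (x 3))
    have h0 : rot (p * 0) (q * 0) x = x := by
      ext i
      fin_cases i <;> simp [rot]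
    have h1 : HasFDerivAt W (fderiv ℝ W x) (rot (p * 0) (q * 0) x) := by
      rw [h0]
      exact (hd x).hasFDerivAt
    have h2 := h1.comp_hasDerivAt 0 hrot
    have h3 : HasDerivAt (fun t : ℝ => W (rot (p * t) (q * t) x)) 0 0 := by
      simp only [hinv]
      exact hasDerivAt_const _ _
    rw [← fderiv_eq_sum_pd]
    exact h2.unique h3
  have k1 := key 1 0
  have k2 := key 0 1
  simp [Fin.sum_univ_four] at k1 k2
  constructor <;> linarith

/-- At `(r, 0, s, 0)` a rotation invariant function satisfies `r W₂₂ = W₁` and `s W₄₄ = W₃`: these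
are the derivatives of the vanishing angular derivatives.  Hence the ultra-hyperbolic equation
becomes the Euler-Poisson-Darboux equation `M_rr + M_r / r = M_ss + M_s / s` for
`M(r, s) = W(r, 0, s, 0)`, here multiplied by `r s`. -/
theorem eulerPoissonDarboux (hW : ContDiff ℝ 2 W) (hinv : ∀ γ δ x, W (rot γ δ x) = W x)
    {r s : ℝ} (hbox : box W !₂[r, 0, s, 0] = 0) :
    r * s * (pd 0 (pd 0 W) !₂[r, 0, s, 0] - pd 2 (pd 2 W) !₂[r, 0, s, 0]) +
      s * pd 0 W !₂[r, 0, s, 0] - r * pd 2 W !₂[r, 0, s, 0] = 0 := by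
  have hp : ∀ j y, DifferentiableAt ℝ (pd j W) y := fun j y => hW.contDiffAt.differentiableAt_pd
  have hc : ∀ k (y : R4), DifferentiableAt ℝ (fun y : R4 => y k) y := fun k y => by fun_prop
  have hpc : ∀ (j k : Fin 4) (y : R4), pd j (fun y : R4 => y k) y = if k = j then 1 else 0 := by
    intro j k y
    have := pd_linear (fun i => if k = i then 1 else 0) j y
    simpa using this
  have second : ∀ (i j : Fin 4), i ≠ j → (∀ x : R4, x i * pd j W x - x j * pd i W x = 0) →
      ∀ x : R4, x j = 0 → x i * pd j (pd j W) x = pd i W x := by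
    intro i j hij h x hx
    have h' : (fun y : R4 => y i * pd j W y) = fun y => y j * pd i W y :=
      funext fun y => by linarith [h y]
    have h1 : pd j (fun y : R4 => y i * pd j W y) x = pd j (fun y : R4 => y j * pd i W y) x := by
      rw [h']
    rw [pd_mul (hc i x) (hp j x), pd_mul (hc j x) (hp i x), hpc, hpc, if_neg hij, if_pos rfl,
      hx] at h1
    linarith
  have h1 := second 0 1 (by decide) (fun x => (angular_deriv_of_invariant hW hinv x).1)
    !₂[r, 0, s, 0] (by simp)
  have h2 := second 2 3 (by decide) (fun x => (angular_deriv_of_invariant hW hinv x).2)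
    !₂[r, 0, s, 0] (by simp)
  simp only [Matrix.cons_val_zero, Matrix.cons_val] at h1 h2
  simp [box, Fin.sum_univ_four, eps] at hbox
  linear_combination r * s * hbox - s * h1 + r * h2

end Invariant

/-- A rotation invariant solution of the ultra-hyperbolic equation is symmetric in the two radii. -/
theorem symm_of_invariant {W : R4 → ℝ} (hW : ContDiff ℝ 2 W)
    (hinv : ∀ γ δ x, W (rot γ δ x) = W x) (hbox : ∀ x ∈ doubleCone, box W x = 0) :
    W !₂[1, 0, 0, 0] = W !₂[0, 0, 1, 0] := by
  -- `A 1` parametrises the plane of the points `(r, 0, s, 0)` by `a = r + s` and `b = r - s`, and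
  -- `A (-1)` is `A 1` with the two radii exchanged
  let A : ℝ → ℝ × ℝ →L[ℝ] R4 := fun c =>
    ((1 / 2 : ℝ) • (ContinuousLinearMap.fst ℝ ℝ ℝ + c • ContinuousLinearMap.snd ℝ ℝ ℝ)).smulRight
        (basisVec 0) +
      ((1 / 2 : ℝ) • (ContinuousLinearMap.fst ℝ ℝ ℝ - c • ContinuousLinearMap.snd ℝ ℝ ℝ)).smulRight
        (basisVec 2)
  have hA : ∀ c a b, A c (a, b) = !₂[(a + c * b) / 2, 0, (a - c * b) / 2, 0] := by
    intro c a b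
    ext i
    fin_cases i <;> simp [A, basisVec] <;> ring
  have hd : Differentiable ℝ W := hW.differentiable (by norm_num)
  have hd' : ∀ j, Differentiable ℝ (pd j W) := fun j y => hW.contDiffAt.differentiableAt_pd
  have hcomp : ∀ (w : R4 → ℝ) (_ : Differentiable ℝ w) (c : ℝ) (z : ℝ × ℝ) (p q : ℝ),
      fderiv ℝ (fun z => w (A c z)) z (p, q) =
        (p + c * q) / 2 * pd 0 w (A c z) + (p - c * q) / 2 * pd 2 w (A c z) := by
    intro w hw c z p q
    have h : HasFDerivAt (fun z => w (A c z)) _ z := (hw _).hasFDerivAt.comp z (A c).hasFDerivAt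
    rw [h.fderiv, ContinuousLinearMap.comp_apply, fderiv_eq_sum_pd, hA]
    simp [Fin.sum_univ_four]
  let N : ℝ × ℝ → ℝ := fun z => W (A 1 z) - W (A (-1) z)
  have hN : ContDiff ℝ 2 N := (hW.comp (A 1).contDiff).sub (hW.comp (A (-1)).contDiff)
  have hNd : ∀ z p q, fderiv ℝ N z (p, q) =
      ((p + q) / 2 * pd 0 W (A 1 z) + (p - q) / 2 * pd 2 W (A 1 z)) -
        ((p - q) / 2 * pd 0 W (A (-1) z) + (p + q) / 2 * pd 2 W (A (-1) z)) := by
    intro z p q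
    have h := fderiv_fun_sub (x := z) (hd.comp (A 1).differentiable z)
      (hd.comp (A (-1)).differentiable z)
    change fderiv ℝ (fun z => W (A 1 z) - W (A (-1) z)) z (p, q) = _
    simp only [Function.comp_def] at h
    rw [h, sub_apply, hcomp W hd, hcomp W hd]
    ring
  have hNab : ∀ z, fderiv ℝ (fun z => fderiv ℝ N z (1, 0)) z (0, 1) =
      1 / 4 * (pd 0 (pd 0 W) (A 1 z) - pd 2 (pd 2 W) (A 1 z)) -
        1 / 4 * (pd 2 (pd 2 W) (A (-1) z) - pd 0 (pd 0 W) (A (-1) z)) := by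
    intro z
    have hsum : Differentiable ℝ fun y => 1 / 2 * (pd 0 W y + pd 2 W y) := fun y =>
      ((hd' 0 y).fun_add (hd' 2 y)).const_mul _
    have e : (fun z => fderiv ℝ N z (1, 0)) = fun z =>
        (fun y => 1 / 2 * (pd 0 W y + pd 2 W y)) (A 1 z) -
          (fun y => 1 / 2 * (pd 0 W y + pd 2 W y)) (A (-1) z) := by
      funext z
      rw [hNd]
      ring
    have hpd : ∀ j y, pd j (fun y => 1 / 2 * (pd 0 W y + pd 2 W y)) y =
        1 / 2 * (pd j (pd 0 W) y + pd j (pd 2 W) y) := fun j y => by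
      rw [pd_const_mul _ ((hd' 0 y).fun_add (hd' 2 y)), pd_add (hd' 0 y) (hd' 2 y)]
    have h := fderiv_fun_sub (x := z) (hsum.comp (A 1).differentiable z)
      (hsum.comp (A (-1)).differentiable z)
    simp only [Function.comp_def] at h
    rw [e, h, sub_apply, hcomp _ hsum, hcomp _ hsum]
    simp only [hpd, fun y => pd_comm (j := 2) (k := 0) (hW.contDiffAt (x := y))]
    ring
  have hN0 : ∀ a, N (a, 0) = 0 := fun a => by simp [N, hA]
  have heq : ∀ a b, 0 ≤ b → b ≤ a → a ≤ 1 →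
      (a ^ 2 - b ^ 2) * fderiv ℝ (fun z => fderiv ℝ N z (1, 0)) (a, b) (0, 1) +
        a * fderiv ℝ N (a, b) (0, 1) - b * fderiv ℝ N (a, b) (1, 0) = 0 := by
    intro a b hb hba ha
    have hr : 0 ≤ (a + b) / 2 := by linarith
    have hs : 0 ≤ (a - b) / 2 := by linarith
    have h1 := eulerPoissonDarboux hW hinv (r := (a + b) / 2) (s := (a - b) / 2)
      (hbox _ (by simp [doubleCone, Real.sqrt_sq, hr, hs]; linarith))
    have h2 := eulerPoissonDarboux hW hinv (r := (a - b) / 2) (s := (a + b) / 2)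
      (hbox _ (by simp [doubleCone, Real.sqrt_sq, hr, hs]; linarith))
    have e1 : A 1 (a, b) = !₂[(a + b) / 2, 0, (a - b) / 2, 0] := by rw [hA]; simp
    have e2 : A (-1) (a, b) = !₂[(a - b) / 2, 0, (a + b) / 2, 0] := by
      rw [hA]; simp [sub_eq_add_neg]
    rw [hNab, hNd, hNd, e1, e2]
    linear_combination h1 + h2
  have h := goursat_eq_zero hN hN0 heq
  have h' : W (A 1 (1, 1)) - W (A (-1) (1, 1)) = 0 := h
  rw [hA, hA] at h'
  norm_num at h'
  linarith

theorem isClosed_doubleCone : IsClosed doubleCone := by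
  refine isClosed_le ?_ continuous_const
  fun_prop

theorem circle_mem_doubleCone (t : ℝ) : circle t ∈ doubleCone := by
  simp [doubleCone, circle]

theorem conjCircle_mem_doubleCone (t : ℝ) : conjCircle t ∈ doubleCone := by
  simp [doubleCone, conjCircle]

theorem rot_mem_doubleCone {x : R4} (hx : x ∈ doubleCone) (α β : ℝ) :
    rot α β x ∈ doubleCone := by
  have h : ∀ t a b : ℝ, (Real.cos t * a - Real.sin t * b) ^ 2 +
      (Real.sin t * a + Real.cos t * b) ^ 2 = a ^ 2 + b ^ 2 := fun t a b => by
    linear_combination (a ^ 2 + b ^ 2) * Real.sin_sq_add_cos_sq t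
  simpa [doubleCone, rot, h] using hx

/-- **Asgeirsson's mean value theorem** for global functions which solve the ultra-hyperbolic
equation on the double cone. -/
theorem asgeirsson {w : R4 → ℝ} (hw : ContDiff ℝ 2 w) (hbox : ∀ x ∈ doubleCone, box w x = 0) :
    ∫ t in (0 : ℝ)..2 * Real.pi, w (circle t) = ∫ t in (0 : ℝ)..2 * Real.pi, w (conjCircle t) := by
  have h := symm_of_invariant (contDiff_rotAverage hw) (rotAverage_rot w) fun x hx =>
    box_rotAverage hw fun α β => hbox _ (rot_mem_doubleCone hx α β)
  have e1 : ∀ α β, rot α β !₂[1, 0, 0, 0] = circle α := fun α β => by simp [rot, circle]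
  have e2 : ∀ α β, rot α β !₂[0, 0, 1, 0] = conjCircle β := fun α β => by simp [rot, conjCircle]
  simp only [rotAverage, e1, e2, intervalIntegral.integral_const, smul_eq_mul, sub_zero,
    intervalIntegral.integral_const_mul] at h
  exact mul_left_cancel₀ Real.two_pi_pos.ne' h

/-- **Asgeirsson's mean value theorem** for functions defined near the double cone, which a cutoff
reduces to the case of global functions. -/
theorem asgeirsson_of_contDiffOn {w : R4 → ℝ} {W : Set R4} (hW : IsOpen W) (hD : doubleCone ⊆ W)
    (hw : ContDiffOn ℝ 2 w W) (hbox : ∀ x ∈ W, box w x = 0) :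
    ∫ t in (0 : ℝ)..2 * Real.pi, w (circle t) = ∫ t in (0 : ℝ)..2 * Real.pi, w (conjCircle t) := by
  obtain ⟨χ, h0, h1, -⟩ := exists_contMDiffMap_zero_one_nhds_of_isClosed (n := 2) 𝓘(ℝ, R4)
    hW.isClosed_compl isClosed_doubleCone (Set.disjoint_compl_left_iff_subset.2 hD)
  have hχ : ContDiff ℝ 2 χ := χ.contMDiff.contDiff
  have hc : ContDiff ℝ 2 fun x => χ x * w x := by
    refine contDiff_iff_contDiffAt.2 fun x => ?_
    by_cases hx : x ∈ W
    · exact hχ.contDiffAt.mul (hw.contDiffAt (hW.mem_nhds hx))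
    · refine (contDiffAt_const (c := (0 : ℝ))).congr_of_eventuallyEq ?_
      filter_upwards [Filter.Eventually.filter_mono (nhds_le_nhdsSet hx) h0] with y hy
      rw [hy, zero_mul]
  have hχ1 : ∀ x ∈ doubleCone, (fun y => χ y * w y) =ᶠ[𝓝 x] w := fun x hx => by
    filter_upwards [Filter.Eventually.filter_mono (nhds_le_nhdsSet hx) h1] with y hy
    rw [hy, one_mul]
  have h := asgeirsson hc fun x hx => (box_congr (hχ1 x hx)).trans (hbox x (hD hx))
  simpa only [fun t => (hχ1 _ (circle_mem_doubleCone t)).eq_of_nhds,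
    fun t => (hχ1 _ (conjCircle_mem_doubleCone t)).eq_of_nhds] using h

/-! ### The mean value property for conformally flat metrics -/

section MeanValue

variable {E H M : Type*} [NormedAddCommGroup E] [NormedSpace ℝ E] [TopologicalSpace H]
  {I : ModelWithCorners ℝ E H} [TopologicalSpace M] [ChartedSpace H M]
  {g : (p : M) → TangentSpace I p → TangentSpace I p → ℝ} {F : R4 → M} {W : Set R4}
  {lam : R4 → ℝ}

/-- The metric `g` pulls back under `F` to `lam η` on `W`, where `η` is the flat metric and the
factor `lam`, of either sign, has no zero on `W`. -/
def IsFlatPullback (I : ModelWithCorners ℝ E H)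
    (g : (p : M) → TangentSpace I p → TangentSpace I p → ℝ) (F : R4 → M) (lam : R4 → ℝ)
    (W : Set R4) : Prop :=
  ∀ x ∈ W, lam x ≠ 0 ∧ ∀ X Y : TangentSpace 𝓘(ℝ, R4) x,
    g (F x) (mfderiv 𝓘(ℝ, R4) I F x X) (mfderiv 𝓘(ℝ, R4) I F x Y) = lam x * flatMetric x X Y

theorem lineIntegral_comp (hF : ∀ x ∈ W, MDifferentiableAt 𝓘(ℝ, R4) I F x)
    (hg : IsFlatPullback I g F lam W) (v : M → ℝ) {c c' : ℝ → R4}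
    (hc : ∀ t, HasDerivAt c (c' t) t) (hcW : ∀ t, c t ∈ W)
    (hunit : ∀ t, |flatMetric (c t) (c' t) (c' t)| = 1) (a b : ℝ) :
    lineIntegral I g v (fun t => F (c t)) a b = ∫ t in a..b, √|lam (c t)| * v (F (c t)) := by
  refine intervalIntegral.integral_congr fun t _ => ?_
  have h1 : mfderiv 𝓘(ℝ, ℝ) I (fun t => F (c t)) t (1 : ℝ) =
      mfderiv 𝓘(ℝ, R4) I F (c t) (c' t) := by
    have h := mfderiv_comp_apply (I := 𝓘(ℝ, ℝ)) t (hF (c t) (hcW t))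
      (hc t).differentiableAt.mdifferentiableAt (1 : ℝ)
    rw [mfderiv_eq_fderiv (f := c)] at h
    have h2 : fderiv ℝ c t (1 : ℝ) = c' t := by
      rw [(hc t).hasFDerivAt.fderiv]
      simp
    exact h.trans (congrArg (fun X : R4 => mfderiv 𝓘(ℝ, R4) I F (c t) X) h2)
  change v (F (c t)) * √|g (F (c t)) (mfderiv 𝓘(ℝ, ℝ) I (fun t => F (c t)) t (1 : ℝ))
    (mfderiv 𝓘(ℝ, ℝ) I (fun t => F (c t)) t (1 : ℝ))| = _
  have h3 : g (F (c t)) (mfderiv 𝓘(ℝ, ℝ) I (fun t => F (c t)) t (1 : ℝ))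
      (mfderiv 𝓘(ℝ, ℝ) I (fun t => F (c t)) t (1 : ℝ)) =
      lam (c t) * flatMetric (c t) (c' t) (c' t) := by
    rw [h1]
    exact (hg (c t) (hcW t)).2 (c' t) (c' t)
  rw [h3, abs_mul, hunit, mul_one, mul_comm]

theorem hasDerivAt_circle (t : ℝ) :
    HasDerivAt circle !₂[-Real.sin t, Real.cos t, 0, 0] t := by
  refine hasDerivAt_of_coord fun i => ?_
  fin_cases i
  · simpa [circle] using Real.hasDerivAt_cos t
  · simpa [circle] using Real.hasDerivAt_sin t
  · simpa [circle] using hasDerivAt_const t (0 : ℝ)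
  · simpa [circle] using hasDerivAt_const t (0 : ℝ)

theorem hasDerivAt_conjCircle (t : ℝ) :
    HasDerivAt conjCircle !₂[0, 0, -Real.sin t, Real.cos t] t := by
  refine hasDerivAt_of_coord fun i => ?_
  fin_cases i
  · simpa [conjCircle] using hasDerivAt_const t (0 : ℝ)
  · simpa [conjCircle] using hasDerivAt_const t (0 : ℝ)
  · simpa [conjCircle] using Real.hasDerivAt_cos t
  · simpa [conjCircle] using Real.hasDerivAt_sin t

/-- The mean value property along the images of the conjugate circles under a map `F` which pulls
the metric back to `lam η`, where `√|lam|` is a solution of the ultra-hyperbolic equation, for a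
function `v` for which `v ∘ F` solves the Laplace equation of `lam η`. -/
theorem lineIntegral_circle_eq (hW : IsOpen W) (hD : doubleCone ⊆ W)
    (hF : ∀ x ∈ W, MDifferentiableAt 𝓘(ℝ, R4) I F x) (hg : IsFlatPullback I g F lam W)
    (hlam : ∀ x ∈ W, ContDiffAt ℝ 2 lam x) (hsqrt : ∀ x ∈ W, box (fun y => √|lam y|) x = 0)
    {v : M → ℝ} (hv : ContDiffOn ℝ 2 (fun x => v (F x)) W)
    (hlap : ∀ x ∈ W, lam x * box (fun x => v (F x)) x +
      ∑ i, eps i * (pd i lam x * pd i (fun x => v (F x)) x) = 0) :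
    lineIntegral I g v (fun t => F (circle t)) 0 (2 * Real.pi) =
      lineIntegral I g v (fun t => F (conjCircle t)) 0 (2 * Real.pi) := by
  rw [lineIntegral_comp hF hg v hasDerivAt_circle (fun t => hD (circle_mem_doubleCone t)),
    lineIntegral_comp hF hg v hasDerivAt_conjCircle (fun t => hD (conjCircle_mem_doubleCone t))]
  · refine asgeirsson_of_contDiffOn (w := fun x => √|lam x| * v (F x)) hW hD ?_ fun x hx => ?_
    · exact ContDiffOn.mul
        (fun x hx => (sqrt_abs_local (hlam x hx) (hg x hx).1).1.contDiffWithinAt) hv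
    · exact box_sqrt_mul (hlam x hx) (hg x hx).1 (hsqrt x hx)
        (hv.contDiffAt (hW.mem_nhds hx)) (hlap x hx)
  · intro t
    have := Real.sin_sq_add_cos_sq t
    simp only [flatMetric, Matrix.cons_val_zero, Matrix.cons_val_one, Matrix.cons_val]
    rw [abs_eq one_pos.le]
    right
    linarith
  · intro t
    have := Real.sin_sq_add_cos_sq t
    simp only [flatMetric, Matrix.cons_val_zero, Matrix.cons_val_one, Matrix.cons_val]
    rw [abs_eq one_pos.le]
    left
    linarith

end MeanValue

theorem flatMetric_eq_sum (x : R4) (X Y : R4) :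
    flatMetric x X Y = ∑ m, eps m * (X m * Y m) := by
  simp [flatMetric, Fin.sum_univ_four, eps]
  ring

theorem flatMetric_basisVec (x : R4) (i j : Fin 4) :
    flatMetric x (basisVec i) (basisVec j) = eta i j := by
  rw [flatMetric_eq_sum]
  by_cases h : i = j
  · simp [basisVec, eta, h]
  · simp [basisVec, eta, h, Ne.symm h]

theorem isFlatConformal_of_fderiv {φ : R4 → R4} {μ : R4 → ℝ} {W : Set R4} (hW : IsOpen W)
    (hφ : ContDiffOn ℝ 3 φ W) (h0 : ∀ x ∈ W, μ x ≠ 0)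
    (h : ∀ x ∈ W, ∀ X Y : R4,
      flatMetric (φ x) (fderiv ℝ φ x X) (fderiv ℝ φ x Y) = μ x * flatMetric x X Y) :
    IsFlatConformal (fun m y => φ y m) μ W where
  isOpen := hW
  contDiffOn := contDiffOn_euclidean.1 hφ
  ne_zero := h0
  conformal x hx i j := by
    have hd : DifferentiableAt ℝ φ x :=
      (hφ.contDiffAt (hW.mem_nhds hx)).differentiableAt (by norm_num)
    rw [← flatMetric_basisVec x, ← h x hx, flatMetric_eq_sum]
    simp only [fderiv_apply_coord hd]
    rfl

/-- The mean value property for the images of the conjugate circles under a conformal map of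
`ℝ^{2,2}`. -/
theorem flat_mean_value {u : R4 → ℝ} {f : R4 → R4} {U : Set R4}
    (hu : IsUltraHyperbolicSolution u) (hU : IsOpen U) (hD : doubleCone ⊆ U)
    (hf : IsConformalOn 𝓘(ℝ, R4) flatMetric f U) :
    lineIntegral 𝓘(ℝ, R4) flatMetric u (fun t => f (circle t)) 0 (2 * Real.pi) =
      lineIntegral 𝓘(ℝ, R4) flatMetric u (fun t => f (conjCircle t)) 0 (2 * Real.pi) := by
  obtain ⟨hsm, μ, hμ⟩ := hf
  have hf3 : ContDiffOn ℝ 3 f U := contDiffOn_infty.1 (contMDiffOn_iff_contDiffOn.1 hsm) 3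
  have hconf : IsFlatConformal (fun m y => f y m) μ U :=
    isFlatConformal_of_fderiv hU hf3 (fun x hx => (hμ x hx).1) fun x hx X Y => by
      have := (hμ x hx).2 X Y
      rwa [mfderiv_eq_fderiv] at this
  have hbox : ∀ x, box u x = 0 := fun x => by
    rw [← hu.2 x]
    simp [box, Fin.sum_univ_four, eps]
    ring
  exact lineIntegral_circle_eq hU hD
    (fun x hx => (hsm.contMDiffAt (hU.mem_nhds hx)).mdifferentiableAt (by simp)) hμ
    (fun x hx => hconf.contDiffAt_factor hx) (fun x hx => hconf.box_sqrt_factor hx)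
    (hu.1.comp_contDiffOn (hf3.of_le (by norm_num)))
    (fun x hx => hconf.box_comp hf3 hx hu.1 (hbox _))

/-! ### Smoothness of the coordinates of the space of oriented lines -/

theorem contMDiff_toLine : ContMDiff ITS2 𝓘(ℝ, R3 × R3) ∞ toLine := by
  have hcoe : ContMDiff (𝓡 2) 𝓘(ℝ, R3) ∞ (fun x : S2 => (x : R3)) := contMDiff_coe_sphere
  have h1 : ContMDiff ITS2 𝓘(ℝ, R3) ∞ fun p : TS2 => (p.1 : R3) :=
    hcoe.comp (Bundle.contMDiff_proj (TangentSpace (𝓡 2)))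
  have h2 : ContMDiff ITS2 𝓘(ℝ, R3).tangent ∞
      (tangentMap (𝓡 2) 𝓘(ℝ, R3) (fun x : S2 => (x : R3))) :=
    (contMDiff_coe_sphere (m := ω)).contMDiff_tangentMap (by simp)
  have h3 : ContMDiff ITS2 𝓘(ℝ, R3) ∞ fun p : TS2 =>
      (tangentMap (𝓡 2) 𝓘(ℝ, R3) (fun x : S2 => (x : R3)) p).2 :=
    (contMDiff_snd_tangentBundle_modelSpace R3 𝓘(ℝ, R3)).comp h2
  exact h1.prodMk_space h3

theorem contDiff_stereoVec {n : WithTop ℕ∞} : ContDiff ℝ n stereoVec := by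
  have hre : ContDiff ℝ n Complex.re := Complex.reCLM.contDiff
  have him : ContDiff ℝ n Complex.im := Complex.imCLM.contDiff
  have hn : ContDiff ℝ n fun ξ : ℂ => ‖ξ‖ ^ 2 := contDiff_norm_sq ℝ
  have h0 : ∀ ξ : ℂ, 1 + ‖ξ‖ ^ 2 ≠ 0 := fun ξ => by positivity
  have hd : ContDiff ℝ n fun ξ : ℂ => 1 + ‖ξ‖ ^ 2 := contDiff_const.add hn
  refine contDiff_euclidean.2 fun i => ?_
  fin_cases i
  · exact (contDiff_const.mul hre).div hd h0
  · exact (contDiff_const.mul him).div hd h0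
  · exact (contDiff_const.sub hn).div hd h0

theorem contMDiff_stereo {n : WithTop ℕ∞} : ContMDiff 𝓘(ℝ, ℂ) (𝓡 2) n stereo :=
  (contDiff_stereoVec.contMDiff).codRestrict_sphere stereoVec_mem

theorem contMDiff_lineOfCoord : ContMDiff 𝓘(ℝ, ℂ × ℂ) ITS2 ∞
    fun z : ℂ × ℂ => lineOfCoord z.1 z.2 := by
  have h1 : ContMDiff 𝓘(ℝ, ℂ).tangent ITS2 ∞ (tangentMap 𝓘(ℝ, ℂ) (𝓡 2) stereo) :=
    (contMDiff_stereo (n := ω)).contMDiff_tangentMap (by simp)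
  have h2 : ContMDiff 𝓘(ℝ, ℂ).tangent 𝓘(ℝ, ℂ).tangent ∞
      ((tangentBundleModelSpaceHomeomorph 𝓘(ℝ, ℂ)).symm :
        ModelProd ℂ ℂ → TangentBundle 𝓘(ℝ, ℂ) ℂ) :=
    contMDiff_tangentBundleModelSpaceHomeomorph_symm
  have h3 := h1.comp h2
  rw [modelWithCornersSelf_prod]
  exact h3

theorem contDiff_xiOf {n : WithTop ℕ∞} : ContDiff ℝ n fun z : ℂ × ℂ => xiOf z.1 z.2 := by
  have hd : ContDiff ℝ n fun z : ℂ × ℂ => z.1 - z.2 := contDiff_fst.sub contDiff_snd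
  have hs : ContDiff ℝ n fun z : ℂ × ℂ => √(4 + ‖z.1 - z.2‖ ^ 2) :=
    (contDiff_const.add (hd.norm_sq ℝ)).sqrt fun z => by positivity
  have hc : ContDiff ℝ n fun z : ℂ × ℂ => ((2 + √(4 + ‖z.1 - z.2‖ ^ 2) : ℝ) : ℂ) :=
    Complex.ofRealCLM.contDiff.comp (contDiff_const.add hs)
  simp only [xiOf, div_eq_mul_inv]
  refine (contDiff_const.mul hd).mul (hc.inv fun z => ?_)
  exact_mod_cast (by positivity : 2 + √(4 + ‖z.1 - z.2‖ ^ 2) ≠ 0)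

theorem contDiff_etaOf {n : WithTop ℕ∞} : ContDiff ℝ n fun z : ℂ × ℂ => etaOf z.1 z.2 := by
  have hs : ContDiff ℝ n fun z : ℂ × ℂ => z.1 + z.2 := contDiff_fst.add contDiff_snd
  exact (hs.sub ((contDiff_xiOf.pow 2).mul (Complex.conjCLE.contDiff.comp hs))).div_const 4

theorem contMDiff_conformalChart : ContMDiff 𝓘(ℝ, R4) ITS2 ∞ conformalChart := by
  have hc : ∀ i j : Fin 4, ContDiff ℝ ∞ fun x : R4 => (⟨x i, x j⟩ : ℂ) := fun i j => by
    have h : (fun x : R4 => (⟨x i, x j⟩ : ℂ)) =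
        fun x => Complex.equivRealProdCLM.symm (x i, x j) := by
      funext x
      apply Complex.ext <;> simp
    rw [h]
    exact Complex.equivRealProdCLM.symm.contDiff.comp (by fun_prop)
  have hz : ContDiff ℝ ∞ fun x : R4 => ((⟨x 0, x 1⟩ : ℂ), (⟨x 2, x 3⟩ : ℂ)) :=
    (hc 0 1).prodMk (hc 2 3)
  have h : ContDiff ℝ ∞ fun x : R4 => (xiOf ⟨x 0, x 1⟩ ⟨x 2, x 3⟩, etaOf ⟨x 0, x 1⟩ ⟨x 2, x 3⟩) :=
    (contDiff_xiOf.comp hz).prodMk (contDiff_etaOf.comp hz)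
  exact contMDiff_lineOfCoord.comp h.contMDiff

theorem toLine_lineOfCoord (ξ η : ℂ) :
    toLine (lineOfCoord ξ η) = (stereoVec ξ, fderiv ℝ stereoVec ξ η) := by
  have h := mfderiv_comp_apply (I := 𝓘(ℝ, ℂ)) (I' := 𝓡 2) (I'' := 𝓘(ℝ, R3)) (f := stereo)
    (g := fun x : S2 => (x : R3)) ξ
    ((contMDiff_coe_sphere (m := 1)).mdifferentiableAt (by norm_num))
    ((contMDiff_stereo (n := 1)).mdifferentiableAt (by norm_num)) η
  have e : ((fun x : S2 => (x : R3)) ∘ stereo) = stereoVec := rfl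
  rw [e, mfderiv_eq_fderiv] at h
  exact Prod.ext rfl h.symm

theorem toLine_fst_norm (p : TS2) : ‖(toLine p).1‖ = 1 := norm_eq_of_mem_sphere p.1

/-! ### Flat coordinates on the space of oriented lines -/

/-- Conformally flat coordinates of the line `z = (ξ, V)` for `ξᵢ ≠ 0`.  With the axes permuted
cyclically so that the `i`-th one is vertical, the line has slope `p`, where the direction `ξ` is
proportional to `(p, 1)`, and meets the horizontal coordinate plane in the point `q`; the
coordinates are `(q₁ + p₂, q₂ - p₁, q₁ - p₂, q₂ + p₁)`. -/
noncomputable def lineChart (i : Fin 3) (z : R3 × R3) : R4 :=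
  !₂[z.2 (i + 1) - z.2 i * (z.1 (i + 1) / z.1 i) + z.1 (i + 2) / z.1 i,
    z.2 (i + 2) - z.2 i * (z.1 (i + 2) / z.1 i) - z.1 (i + 1) / z.1 i,
    z.2 (i + 1) - z.2 i * (z.1 (i + 1) / z.1 i) - z.1 (i + 2) / z.1 i,
    z.2 (i + 2) - z.2 i * (z.1 (i + 2) / z.1 i) + z.1 (i + 1) / z.1 i]

theorem contDiffAt_lineChart {n : WithTop ℕ∞} {i : Fin 3} {z : R3 × R3} (hz : z.1 i ≠ 0) :
    ContDiffAt ℝ n (lineChart i) z := by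
  have h1 : ∀ j, ContDiffAt ℝ n (fun z : R3 × R3 => z.1 j) z := fun j => by fun_prop
  have h2 : ∀ j, ContDiffAt ℝ n (fun z : R3 × R3 => z.2 j) z := fun j => by fun_prop
  have hp : ∀ j, ContDiffAt ℝ n (fun z : R3 × R3 => z.1 j / z.1 i) z := fun j =>
    (h1 j).div (h1 i) hz
  have hq : ∀ j, ContDiffAt ℝ n (fun z : R3 × R3 => z.2 j - z.2 i * (z.1 j / z.1 i)) z := fun j =>
    (h2 j).sub ((h2 i).mul (hp j))
  refine contDiffAt_euclidean.2 fun m => ?_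
  fin_cases m
  · exact (hq (i + 1)).add (hp (i + 2))
  · exact (hq (i + 2)).sub (hp (i + 1))
  · exact (hq (i + 1)).sub (hp (i + 2))
  · exact (hq (i + 2)).add (hp (i + 1))

theorem fderiv_lineChart {i : Fin 3} {z : R3 × R3} (hz : z.1 i ≠ 0) (Z : R3 × R3) :
    fderiv ℝ (lineChart i) z Z =
      let dp := fun j => (Z.1 j * z.1 i - z.1 j * Z.1 i) / z.1 i ^ 2
      let dq := fun j => Z.2 j - (Z.2 i * (z.1 j / z.1 i) + z.2 i * dp j)
      !₂[dq (i + 1) + dp (i + 2), dq (i + 2) - dp (i + 1), dq (i + 1) - dp (i + 2),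
        dq (i + 2) + dp (i + 1)] := by
  have hline : HasDerivAt (fun t : ℝ => z + t • Z) Z 0 := by
    simpa using ((hasDerivAt_id (0 : ℝ)).smul_const Z).const_add z
  have h1 : ∀ j, HasDerivAt (fun t : ℝ => (z + t • Z).1 j) (Z.1 j) 0 := fun j => by
    simpa using ((hasDerivAt_id (0 : ℝ)).mul_const (Z.1 j)).const_add (z.1 j)
  have h2 : ∀ j, HasDerivAt (fun t : ℝ => (z + t • Z).2 j) (Z.2 j) 0 := fun j => by
    simpa using ((hasDerivAt_id (0 : ℝ)).mul_const (Z.2 j)).const_add (z.2 j)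
  have e0 : z + (0 : ℝ) • Z = z := by simp
  have hp : ∀ j, HasDerivAt (fun t : ℝ => (z + t • Z).1 j / (z + t • Z).1 i)
      ((Z.1 j * z.1 i - z.1 j * Z.1 i) / z.1 i ^ 2) 0 := fun j => by
    have := (h1 j).fun_div (h1 i) (by rwa [e0])
    rwa [e0] at this
  have hq : ∀ j, HasDerivAt (fun t : ℝ => (z + t • Z).2 j -
      (z + t • Z).2 i * ((z + t • Z).1 j / (z + t • Z).1 i))
      (Z.2 j - (Z.2 i * (z.1 j / z.1 i) +
        z.2 i * ((Z.1 j * z.1 i - z.1 j * Z.1 i) / z.1 i ^ 2))) 0 := fun j => by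
    have := (h2 j).fun_sub ((h2 i).fun_mul (hp j))
    rwa [e0] at this
  have hf : HasFDerivAt (lineChart i) (fderiv ℝ (lineChart i) z) (z + (0 : ℝ) • Z) := by
    rw [e0]
    exact ((contDiffAt_lineChart (n := 1) hz).differentiableAt (by norm_num)).hasFDerivAt
  refine (hf.comp_hasDerivAt 0 hline).unique (hasDerivAt_of_coord fun m => ?_)
  fin_cases m
  · exact (hq (i + 1)).fun_add (hp (i + 2))
  · exact (hq (i + 2)).fun_sub (hp (i + 1))
  · exact (hq (i + 1)).fun_sub (hp (i + 2))
  · exact (hq (i + 2)).fun_add (hp (i + 1))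

/-- Expansion of the triple product along the axes taken in the cyclic order `i, i + 1, i + 2`. -/
theorem triple_cyclic (a b c : R3) (i : Fin 3) :
    triple a b c = a i * (b (i + 1) * c (i + 2) - b (i + 2) * c (i + 1)) +
      a (i + 1) * (b (i + 2) * c i - b i * c (i + 2)) +
      a (i + 2) * (b i * c (i + 1) - b (i + 1) * c i) := by
  rw [triple, Matrix.det_fin_three]
  fin_cases i <;> simp <;> ring

/-- In the coordinates `lineChart i` the canonical metric is `ξᵢ² / 4` times the flat metric. -/
theorem triple_eq_flatMetric {i : Fin 3} {z : R3 × R3} (hz : z.1 i ≠ 0) (X Y : R3 × R3) (x : R4) :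
    (1 / 2) * (triple z.1 X.2 Y.1 + triple z.1 Y.2 X.1) =
      z.1 i ^ 2 / 4 *
        flatMetric x (fderiv ℝ (lineChart i) z X) (fderiv ℝ (lineChart i) z Y) := by
  rw [fderiv_lineChart hz, fderiv_lineChart hz, triple_cyclic _ _ _ i, triple_cyclic _ _ _ i]
  simp only [flatMetric, Matrix.cons_val_zero, Matrix.cons_val_one, Matrix.cons_val]
  field_simp
  ring

/-- The square root of the conformal factor `ξᵢ² / 4`, as a function of the flat coordinates. -/
noncomputable def chartWeight (y : R4) : ℝ :=
  1 / (2 * √(1 + ((y 3 - y 1) / 2) ^ 2 + ((y 0 - y 2) / 2) ^ 2))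

theorem chartWeight_lineChart {i : Fin 3} {z : R3 × R3} (hz : z.1 i ≠ 0) (hn : ‖z.1‖ = 1) :
    chartWeight (lineChart i z) = |z.1 i| / 2 := by
  have hs : z.1 i ^ 2 + z.1 (i + 1) ^ 2 + z.1 (i + 2) ^ 2 = 1 := by
    have h := EuclideanSpace.norm_sq_eq z.1
    rw [hn] at h
    simp only [Fin.sum_univ_three, Real.norm_eq_abs, sq_abs] at h
    fin_cases i <;> simp <;> linarith
  have e : 1 + ((lineChart i z 3 - lineChart i z 1) / 2) ^ 2 +
      ((lineChart i z 0 - lineChart i z 2) / 2) ^ 2 = (|z.1 i|⁻¹) ^ 2 := by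
    simp only [lineChart, Matrix.cons_val_zero, Matrix.cons_val_one, Matrix.cons_val]
    rw [inv_pow, sq_abs]
    field_simp
    linear_combination 4 * hs
  rw [chartWeight, e, Real.sqrt_sq (by positivity)]
  have := abs_pos.2 hz
  field_simp

theorem contDiff_chartWeight {n : WithTop ℕ∞} : ContDiff ℝ n chartWeight := by
  have h : ContDiff ℝ n fun y : R4 => 1 + ((y 3 - y 1) / 2) ^ 2 + ((y 0 - y 2) / 2) ^ 2 := by
    fun_prop
  refine contDiff_const.div (contDiff_const.mul (h.sqrt fun y => by positivity)) fun y => ?_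
  positivity

/-- `chartWeight` only depends on `x₁ - x₃` and `x₂ - x₄`. -/
theorem box_chartWeight (x : R4) : box chartWeight x = 0 := by
  have hw : ContDiff ℝ 2 chartWeight := contDiff_chartWeight
  have key : ∀ i j : Fin 4, (∀ (t : ℝ) (y : R4),
      chartWeight (y + t • (basisVec i + basisVec j)) = chartWeight y) →
      pd i chartWeight = fun y => -1 * pd j chartWeight y := by
    intro i j h
    funext y
    have hl : HasDerivAt (fun t : ℝ => y + t • (basisVec i + basisVec j))
        (basisVec i + basisVec j) 0 := by
      simpa using ((hasDerivAt_id (0 : ℝ)).smul_const (basisVec i + basisVec j)).const_add y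
    have hf : HasFDerivAt chartWeight (fderiv ℝ chartWeight y)
        (y + (0 : ℝ) • (basisVec i + basisVec j)) := by
      rw [zero_smul, add_zero]
      exact (hw.differentiable (by norm_num) y).hasFDerivAt
    have h1 := hf.comp_hasDerivAt 0 hl
    have h2 : HasDerivAt (fun t : ℝ => chartWeight (y + t • (basisVec i + basisVec j))) 0 0 := by
      simp only [h]
      exact hasDerivAt_const _ _
    have h3 := h1.unique h2
    rw [map_add] at h3
    change pd i chartWeight y + pd j chartWeight y = 0 at h3
    linarith
  have second : ∀ i j : Fin 4, pd i chartWeight = (fun y => -1 * pd j chartWeight y) →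
      pd i (pd i chartWeight) x = pd j (pd j chartWeight) x := by
    intro i j h
    have hd : ∀ k, DifferentiableAt ℝ (pd k chartWeight) x := fun k =>
      hw.contDiffAt.differentiableAt_pd
    calc pd i (pd i chartWeight) x = -1 * pd i (pd j chartWeight) x := by
          rw [← pd_const_mul _ (hd j), ← h]
      _ = -1 * pd j (pd i chartWeight) x := by rw [pd_comm hw.contDiffAt]
      _ = pd j (pd j chartWeight) x := by rw [h, pd_const_mul _ (hd j)]; ring
  have h02 := second 0 2 (key 0 2 fun t y => by simp [chartWeight, basisVec])
  have h13 := second 1 3 (key 1 3 fun t y => by simp [chartWeight, basisVec])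
  simp [box, Fin.sum_univ_four, eps, h02, h13]

theorem fderiv_stereoVec (ξ η : ℂ) :
    fderiv ℝ stereoVec ξ η =
      let n := ξ.re ^ 2 + ξ.im ^ 2
      let dn := 2 * (ξ.re * η.re + ξ.im * η.im)
      !₂[(2 * η.re * (1 + n) - 2 * ξ.re * dn) / (1 + n) ^ 2,
        (2 * η.im * (1 + n) - 2 * ξ.im * dn) / (1 + n) ^ 2,
        (-dn * (1 + n) - (1 - n) * dn) / (1 + n) ^ 2] := by
  have hn : ∀ ζ : ℂ, ‖ζ‖ ^ 2 = ζ.re ^ 2 + ζ.im ^ 2 := fun ζ => by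
    rw [← Complex.normSq_eq_norm_sq, Complex.normSq_apply]; ring
  have hline : HasDerivAt (fun t : ℝ => ξ + t • η) η 0 := by
    simpa using ((hasDerivAt_id (0 : ℝ)).smul_const η).const_add ξ
  have e0 : ξ + (0 : ℝ) • η = ξ := by simp
  have hre : HasDerivAt (fun t : ℝ => (ξ + t • η).re) η.re 0 := by
    simpa using ((hasDerivAt_id (0 : ℝ)).mul_const η.re).const_add ξ.re
  have him : HasDerivAt (fun t : ℝ => (ξ + t • η).im) η.im 0 := by
    simpa using ((hasDerivAt_id (0 : ℝ)).mul_const η.im).const_add ξ.im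
  have hsq : HasDerivAt (fun t : ℝ => ‖ξ + t • η‖ ^ 2) (2 * (ξ.re * η.re + ξ.im * η.im)) 0 := by
    simp only [hn]
    convert! (hre.fun_pow 2).fun_add (him.fun_pow 2) using 1
    simp
    ring
  have h0 : 1 + ‖ξ + (0 : ℝ) • η‖ ^ 2 ≠ 0 := by positivity
  have hf : HasFDerivAt stereoVec (fderiv ℝ stereoVec ξ) (ξ + (0 : ℝ) • η) := by
    rw [e0]
    exact (contDiff_stereoVec.differentiable (n := 1) (by norm_num) ξ).hasFDerivAt
  refine (hf.comp_hasDerivAt 0 hline).unique (hasDerivAt_of_coord fun m => ?_)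
  have a1 := (hre.const_mul 2).fun_div (hsq.const_add 1) h0
  have a2 := (him.const_mul 2).fun_div (hsq.const_add 1) h0
  have a3 := (hsq.const_sub 1).fun_div (hsq.const_add 1) h0
  rw [e0, hn] at a1 a2 a3
  fin_cases m
  · exact a1
  · exact a2
  · exact a3

/-- The coordinates `lineChart 2` invert `conformalChart`. -/
theorem lineChart_conformalChart (x : R4) :
    (toLine (conformalChart x)).1 2 ≠ 0 ∧ lineChart 2 (toLine (conformalChart x)) = x := by
  obtain ⟨hlt, h1, h2⟩ := confZ_of_xi_eta ⟨x 0, x 1⟩ ⟨x 2, x 3⟩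
  have hc : toLine (conformalChart x) = _ := toLine_lineOfCoord _ _
  set ξ := xiOf ⟨x 0, x 1⟩ ⟨x 2, x 3⟩
  set η := etaOf ⟨x 0, x 1⟩ ⟨x 2, x 3⟩
  have hn : ‖ξ‖ ^ 2 = ξ.re ^ 2 + ξ.im ^ 2 := by
    rw [← Complex.normSq_eq_norm_sq, Complex.normSq_apply]; ring
  have hn1 : ξ.re ^ 2 + ξ.im ^ 2 < 1 := by
    rw [← hn]
    exact pow_lt_one₀ (norm_nonneg _) hlt two_ne_zero
  have hm : 1 - (ξ.re ^ 2 + ξ.im ^ 2) ≠ 0 := by linarith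
  have hp : 1 + (ξ.re ^ 2 + ξ.im ^ 2) ≠ 0 := by positivity
  have hpm : 1 - (ξ.re ^ 2 + ξ.im ^ 2) ^ 2 ≠ 0 := by
    have : 1 - (ξ.re ^ 2 + ξ.im ^ 2) ^ 2 =
      (1 - (ξ.re ^ 2 + ξ.im ^ 2)) * (1 + (ξ.re ^ 2 + ξ.im ^ 2)) := by ring
    rw [this]
    exact mul_ne_zero hm hp
  have hcoef : (2 / (1 - (‖ξ‖ : ℂ) ^ 4)) =
      ((2 / (1 - (ξ.re ^ 2 + ξ.im ^ 2) ^ 2) : ℝ) : ℂ) := by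
    rw [← hn]
    push_cast
    ring
  have hnc : (‖ξ‖ : ℂ) ^ 2 = ((ξ.re ^ 2 + ξ.im ^ 2 : ℝ) : ℂ) := by
    rw [← hn]
    push_cast
    rfl
  rw [confZ₁, hcoef, hnc] at h1
  rw [confZ₂, hcoef, hnc] at h2
  have r1 := congrArg Complex.re h1
  have i1 := congrArg Complex.im h1
  have r2 := congrArg Complex.re h2
  have i2 := congrArg Complex.im h2
  rw [Complex.re_ofReal_mul] at r1 r2
  rw [Complex.im_ofReal_mul] at i1 i2
  simp [sq] at r1 i1 r2 i2
  rw [hc, fderiv_stereoVec]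
  have hv : (stereoVec ξ) 2 = (1 - (ξ.re ^ 2 + ξ.im ^ 2)) / (1 + (ξ.re ^ 2 + ξ.im ^ 2)) := by
    rw [← hn]; rfl
  have hv0 : (stereoVec ξ) 0 = 2 * ξ.re / (1 + (ξ.re ^ 2 + ξ.im ^ 2)) := by rw [← hn]; rfl
  have hv1 : (stereoVec ξ) 1 = 2 * ξ.im / (1 + (ξ.re ^ 2 + ξ.im ^ 2)) := by rw [← hn]; rfl
  refine ⟨by rw [hv]; exact div_ne_zero hm hp, ?_⟩
  set n := ξ.re ^ 2 + ξ.im ^ 2 with hndef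
  have t01 : (2 : Fin 3) + 1 = 0 := rfl
  have t02 : (2 : Fin 3) + 2 = 1 := rfl
  have hnn : ξ.re * ξ.re + ξ.im * ξ.im = n := by rw [hndef]; ring
  rw [hnn, (by ring : 1 - n * n = (1 - n) * (1 + n))] at r1 i1 r2 i2
  clear_value n
  ext m
  fin_cases m
  all_goals
    simp only [lineChart, t01, t02, hv, hv0, hv1, Fin.zero_eta, Fin.mk_one, Fin.reduceFinMk,
      Matrix.cons_val_zero, Matrix.cons_val_one, Matrix.cons_val]
  · rw [← r1]
    field_simp
    rw [hndef]
    ring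
  · rw [← i1]
    field_simp
    rw [hndef]
    ring
  · rw [← r2]
    field_simp
    rw [hndef]
    ring
  · rw [← i2]
    field_simp
    rw [hndef]
    ring

/-! ### The mean value property on the space of oriented lines -/

section Lines

variable {F : R4 → TS2} {x : R4}

theorem fderiv_toLine_comp (hF : MDifferentiableAt 𝓘(ℝ, R4) ITS2 F x)
    (X : TangentSpace 𝓘(ℝ, R4) x) :
    mfderiv ITS2 𝓘(ℝ, R3 × R3) toLine (F x) (mfderiv 𝓘(ℝ, R4) ITS2 F x X) =
      fderiv ℝ (fun y => toLine (F y)) x X := by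
  have h := mfderiv_comp_apply (I := 𝓘(ℝ, R4)) (I' := ITS2) (I'' := 𝓘(ℝ, R3 × R3)) (f := F)
    (g := toLine) x (contMDiff_toLine.mdifferentiableAt (by simp)) hF X
  rw [mfderiv_eq_fderiv] at h
  exact h.symm

/-- The canonical metric in the flat coordinates `lineChart i`, pulled back by a map `F`. -/
theorem canonicalMetric_mfderiv (hF : MDifferentiableAt 𝓘(ℝ, R4) ITS2 F x)
    (hL : DifferentiableAt ℝ (fun y => toLine (F y)) x)
    {i : Fin 3} (hi : (toLine (F x)).1 i ≠ 0) (X Y : TangentSpace 𝓘(ℝ, R4) x) :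
    canonicalMetric (F x) (mfderiv 𝓘(ℝ, R4) ITS2 F x X) (mfderiv 𝓘(ℝ, R4) ITS2 F x Y) =
      (toLine (F x)).1 i ^ 2 / 4 *
        flatMetric x (fderiv ℝ (fun y => lineChart i (toLine (F y))) x X)
          (fderiv ℝ (fun y => lineChart i (toLine (F y))) x Y) := by
  have hc : fderiv ℝ (fun y => lineChart i (toLine (F y))) x =
      (fderiv ℝ (lineChart i) (toLine (F x))).comp (fderiv ℝ (fun y => toLine (F y)) x) :=
    fderiv_comp (g := lineChart i) (f := fun y => toLine (F y)) x
      ((contDiffAt_lineChart (n := 1) hi).differentiableAt (by norm_num)) hL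
  rw [hc]
  have h := triple_eq_flatMetric hi (fderiv ℝ (fun y => toLine (F y)) x X)
    (fderiv ℝ (fun y => toLine (F y)) x Y) x
  rw [← fderiv_toLine_comp hF, ← fderiv_toLine_comp hF] at h
  refine h.trans ?_
  rw [fderiv_toLine_comp hF, fderiv_toLine_comp hF]
  rfl

theorem contDiffAt_toLine_comp (hF : ContMDiffAt 𝓘(ℝ, R4) ITS2 ∞ F x) :
    ContDiffAt ℝ ∞ (fun y => toLine (F y)) x :=
  (contMDiff_toLine.contMDiffAt.comp x hF).contDiffAt

/-- `conformalChart` pulls the canonical metric back to a multiple of the flat metric. -/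
theorem isFlatPullback_conformalChart :
    IsFlatPullback ITS2 canonicalMetric conformalChart
      (fun x => (toLine (conformalChart x)).1 2 ^ 2 / 4) Set.univ := by
  intro x _
  have h2 := (lineChart_conformalChart x).1
  refine ⟨by positivity, fun X Y => ?_⟩
  have hF := contMDiff_conformalChart x
  have e : (fun y => lineChart 2 (toLine (conformalChart y))) = fun y => y :=
    funext fun y => (lineChart_conformalChart y).2
  rw [canonicalMetric_mfderiv (hF.mdifferentiableAt (by simp))
    ((contDiffAt_toLine_comp hF).differentiableAt (by simp)) h2, e, fderiv_fun_id]
  rfl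

section Pullback

variable {lam : R4 → ℝ} {W : Set R4}

/-- The square root of the factor of a conformally flat pull back of the canonical metric solves the
ultra-hyperbolic equation: near each point the map `F` is, in one of the charts `lineChart i`, a
conformal map of flat space, and the weight of the chart solves the equation. -/
theorem box_sqrt_of_isFlatPullback (hW : IsOpen W) (hF : ContMDiffOn 𝓘(ℝ, R4) ITS2 ∞ F W)
    (hg : IsFlatPullback ITS2 canonicalMetric F lam W) (hx : x ∈ W) :
    ContDiffAt ℝ 2 lam x ∧ box (fun y => √|lam y|) x = 0 := by
  have hFat : ∀ y ∈ W, ContMDiffAt 𝓘(ℝ, R4) ITS2 ∞ F y := fun y hy =>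
    hF.contMDiffAt (hW.mem_nhds hy)
  have hLat : ∀ y ∈ W, ContDiffAt ℝ ∞ (fun y => toLine (F y)) y := fun y hy =>
    contDiffAt_toLine_comp (hFat y hy)
  obtain ⟨i, hi⟩ : ∃ i, (toLine (F x)).1 i ≠ 0 := by
    by_contra! h
    have h0 : (toLine (F x)).1 = 0 := by
      ext i
      exact h i
    have h1 := toLine_fst_norm (F x)
    rw [h0, norm_zero] at h1
    exact zero_ne_one h1
  have hproj : ContDiff ℝ ∞ fun z : R3 × R3 => z.1 i := by fun_prop
  have hLi : ∀ y ∈ W, ContDiffAt ℝ ∞ (fun y => (toLine (F y)).1 i) y := fun y hy =>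
    hproj.contDiffAt.comp y (hLat y hy)
  have hcoord : ContinuousOn (fun y => (toLine (F y)).1 i) W := fun y hy =>
    (hLi y hy).continuousAt.continuousWithinAt
  let W' := W ∩ (fun y => (toLine (F y)).1 i) ⁻¹' {0}ᶜ
  have hW' : IsOpen W' := hcoord.isOpen_inter_preimage hW isOpen_compl_singleton
  have hxW' : x ∈ W' := ⟨hx, hi⟩
  let φ : R4 → R4 := fun y => lineChart i (toLine (F y))
  let μ : R4 → ℝ := fun y => 4 * lam y / (toLine (F y)).1 i ^ 2
  have hφ : ContDiffOn ℝ 3 φ W' := fun y hy =>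
    (ContDiffAt.comp (g := lineChart i) (f := fun y => toLine (F y)) y (contDiffAt_lineChart hy.2)
      (contDiffAt_infty.1 (hLat y hy.1) 3)).contDiffWithinAt
  have hconf : IsFlatConformal (fun m y => φ y m) μ W' := by
    refine isFlatConformal_of_fderiv hW' hφ (fun y hy => ?_) fun y hy X Y => ?_
    · exact div_ne_zero (mul_ne_zero four_ne_zero (hg y hy.1).1) (pow_ne_zero 2 hy.2)
    · have h1 := (canonicalMetric_mfderiv ((hFat y hy.1).mdifferentiableAt (by simp))
        ((hLat y hy.1).differentiableAt (by simp)) hy.2 X Y).symm.trans ((hg y hy.1).2 X Y)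
      have h2 : (toLine (F y)).1 i ≠ 0 := hy.2
      change flatMetric y (fderiv ℝ φ y X) (fderiv ℝ φ y Y) = μ y * flatMetric y X Y
      change (toLine (F y)).1 i ^ 2 / 4 * flatMetric y (fderiv ℝ φ y X) (fderiv ℝ φ y Y) = _ at h1
      simp only [μ]
      field_simp
      linear_combination 4 * h1
  have e1 : lam =ᶠ[𝓝 x] fun y => (toLine (F y)).1 i ^ 2 / 4 * μ y := by
    filter_upwards [hW'.mem_nhds hxW'] with y hy
    have h2 : (toLine (F y)).1 i ≠ 0 := hy.2
    simp only [μ]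
    field_simp
  have e2 : (fun y => √|lam y|) =ᶠ[𝓝 x] fun y => √|μ y| * chartWeight (φ y) := by
    filter_upwards [hW'.mem_nhds hxW', e1] with y hy h1
    rw [chartWeight_lineChart hy.2 (toLine_fst_norm _), h1, abs_mul,
      abs_of_nonneg (by positivity : 0 ≤ (toLine (F y)).1 i ^ 2 / 4),
      Real.sqrt_mul (by positivity), Real.sqrt_div (by positivity), Real.sqrt_sq_eq_abs,
      show (4 : ℝ) = 2 ^ 2 by norm_num, Real.sqrt_sq (by norm_num), mul_comm]
  refine ⟨ContDiffAt.congr_of_eventuallyEq ?_ e1, ?_⟩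
  · have hc : ContDiffAt ℝ 2 (fun y => (toLine (F y)).1 i) x := contDiffAt_infty.1 (hLi x hx) 2
    exact ((hc.pow 2).div_const 4).mul (hconf.contDiffAt_factor hxW')
  · rw [box_congr e2]
    exact hconf.box_sqrt_mul_comp hφ hxW' contDiff_chartWeight (box_chartWeight _)

/-- A map which pulls the metric back to a non-degenerate one is an immersion, hence a local
coordinate system by equality of dimensions. -/
theorem isLocalCoord_of_isFlatPullback (hW : IsOpen W) (hF : ContMDiffOn 𝓘(ℝ, R4) ITS2 ∞ F W)
    (hg : IsFlatPullback ITS2 canonicalMetric F lam W) : IsLocalCoord ITS2 F W where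
  isOpen := hW
  smooth := hF
  bijective x hx := by
    have hinj : Function.Injective (mfderiv 𝓘(ℝ, R4) ITS2 F x) := by
      intro (X : R4) (Y : R4) hXY
      -- the flat metric is non-degenerate
      have h : ∀ Z : R4, flatMetric x X Z = flatMetric x Y Z := fun Z => by
        have h1 := (hg x hx).2 X Z
        rw [hXY, (hg x hx).2 Y Z] at h1
        exact (mul_left_cancel₀ (hg x hx).1 h1).symm
      refine PiLp.ext fun j => ?_
      have hj := h (basisVec j)
      rw [flatMetric_eq_sum, flatMetric_eq_sum] at hj
      have hb : ∀ Z : R4, ∑ m, eps m * (Z m * basisVec j m) = eps j * Z j := fun Z => by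
        simp [basisVec]
      rw [hb, hb] at hj
      exact mul_left_cancel₀ (left_ne_zero_of_mul_eq_one (eps_mul_self j)) hj
    let T : R4 →ₗ[ℝ] EuclideanSpace ℝ (Fin 2) × EuclideanSpace ℝ (Fin 2) :=
      (mfderiv 𝓘(ℝ, R4) ITS2 F x).toLinearMap
    have hfin : Module.finrank ℝ R4 =
        Module.finrank ℝ (EuclideanSpace ℝ (Fin 2) × EuclideanSpace ℝ (Fin 2)) := by simp
    exact ⟨hinj, (LinearMap.injective_iff_surjective_of_finrank_eq_finrank (f := T) hfin).1 hinj⟩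

end Pullback

/-- The mean value property for the images of the conjugate circles under a conformal map of the
space of oriented lines. -/
theorem lines_mean_value {v : TS2 → ℝ} {f : TS2 → TS2} {U : Set TS2}
    (hv : IsLaplaceSolution ITS2 canonicalMetric v) (hU : IsOpen U)
    (hD : conformalChart '' doubleCone ⊆ U) (hf : IsConformalOn ITS2 canonicalMetric f U) :
    lineIntegral ITS2 canonicalMetric v (fun t => f (conformalChart (circle t)))
        0 (2 * Real.pi) =
      lineIntegral ITS2 canonicalMetric v (fun t => f (conformalChart (conjCircle t)))
        0 (2 * Real.pi) := by
  obtain ⟨hsm, μ, hμ⟩ := hf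
  let W : Set R4 := conformalChart ⁻¹' U
  have hW : IsOpen W := hU.preimage contMDiff_conformalChart.continuous
  let F : R4 → TS2 := fun x => f (conformalChart x)
  let lam : R4 → ℝ := fun x => μ (conformalChart x) * ((toLine (conformalChart x)).1 2 ^ 2 / 4)
  have hF : ContMDiffOn 𝓘(ℝ, R4) ITS2 ∞ F W :=
    hsm.comp contMDiff_conformalChart.contMDiffOn fun x hx => hx
  have hFat : ∀ x ∈ W, ContMDiffAt 𝓘(ℝ, R4) ITS2 ∞ F x := fun x hx =>
    hF.contMDiffAt (hW.mem_nhds hx)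
  have hg : IsFlatPullback ITS2 canonicalMetric F lam W := by
    intro x hx
    obtain ⟨h0, h1⟩ := isFlatPullback_conformalChart x trivial
    obtain ⟨h2, h3⟩ := hμ (conformalChart x) hx
    refine ⟨mul_ne_zero h2 h0, fun X Y => ?_⟩
    have hc : ∀ Z : TangentSpace 𝓘(ℝ, R4) x, mfderiv 𝓘(ℝ, R4) ITS2 F x Z =
        mfderiv ITS2 ITS2 f (conformalChart x)
          (mfderiv 𝓘(ℝ, R4) ITS2 conformalChart x Z) := fun Z =>
      mfderiv_comp_apply x ((hsm.contMDiffAt (hU.mem_nhds hx)).mdifferentiableAt (by simp))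
        (contMDiff_conformalChart.mdifferentiableAt (by simp)) Z
    rw [hc, hc, mul_assoc, ← h1]
    exact h3 _ _
  have hlam := fun x (hx : x ∈ W) => box_sqrt_of_isFlatPullback hW hF hg hx
  have hvF : ContDiffOn ℝ 2 (fun x => v (F x)) W := fun x hx =>
    (hv.1.contMDiffAt.comp x (contMDiffAt_infty.1 (hFat x hx) 2)).contDiffAt.contDiffWithinAt
  refine lineIntegral_circle_eq (F := F) (lam := lam) (W := W) hW
    (fun x hx => hD ⟨x, hx, rfl⟩)
    (fun x hx => (hFat x hx).mdifferentiableAt (by simp)) hg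
    (fun x hx => (hlam x hx).1) (fun x hx => (hlam x hx).2) hvF fun x hx => ?_
  refine box_of_coordLaplacian ((hlam x hx).1.differentiableAt (by norm_num)) (hg x hx).1 ?_
    (hv.2 F W (isLocalCoord_of_isFlatPullback hW hF hg) x hx)
  filter_upwards [hW.mem_nhds hx] with y hy
  ext j k
  refine ((hg y hy).2 (basisVec j) (basisVec k)).trans ?_
  rw [flatMetric_basisVec]
  rfl

end Lines

end NeutralGeometry

/-- The mean value property is conformally invariant, on the space `TS²` of oriented lines with its
canonical metric, and on the flat space `ℝ^{2,2}`. -/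
theorem theorem1p4 :
    (∀ (v : TS2 → ℝ) (f : TS2 → TS2) (U : Set TS2),
      IsLaplaceSolution ITS2 canonicalMetric v →
      IsOpen U → conformalChart '' doubleCone ⊆ U →
      IsConformalOn ITS2 canonicalMetric f U →
      lineIntegral ITS2 canonicalMetric v (fun t => f (conformalChart (circle t)))
          0 (2 * Real.pi) =
        lineIntegral ITS2 canonicalMetric v (fun t => f (conformalChart (conjCircle t)))
          0 (2 * Real.pi)) ∧
    (∀ (u : R4 → ℝ) (f : R4 → R4) (U : Set R4),
      IsUltraHyperbolicSolution u →
      IsOpen U → doubleCone ⊆ U →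
      IsConformalOn 𝓘(ℝ, R4) flatMetric f U →
      lineIntegral 𝓘(ℝ, R4) flatMetric u (fun t => f (circle t)) 0 (2 * Real.pi) =
        lineIntegral 𝓘(ℝ, R4) flatMetric u (fun t => f (conjCircle t)) 0 (2 * Real.pi)) :=
  ⟨fun _ _ _ hv hU hD hf => lines_mean_value hv hU hD hf,
    fun _ _ _ hu hU hD hf => flat_mean_value hu hU hD hf⟩
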